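/- **Setting (preference-based RL, PbRL).** Consider an episodic MDP with finite state space $\mathcal S$, finite nonempty action space $\mathcal A$, horizon $H$, fixed initial state $s_1$ and time-homogeneous transition kernel $\mathbb P(s'\mid s,a)$. Let $\mathrm{Traj}=(\mathcal S\times\mathcal A)^H$ and let $\Pi$ be the set of all (randomized) history-dependent policies. A preference function is a map $\mathbb T:\mathrm{Traj}\times\mathrm{Traj}\to[0,1]$ with $\mathbb T(\tau_1,\tau_2)+\mathbb T(\tau_2,\tau_1)=1$; put $\mathbb T(\pi_1,\pi_2)=\mathbb E\,\mathbb T(\tau_1,\tau_2)$ for independent $\tau_1\sim(\mathbb P,\pi_1)$, $\tau_2\sim(\mathbb P,\pi_2)$. In each of $K$ episodes a PbRL algorithm, which may be randomized and may know $K$, chooses a pair of policies $(\pi_{k,1},\pi_{k,2})$ in $\Pi$ from the observations of the earlier episodes, executes both independently, and observes the two trajectories $\tau_{k,1},\tau_{k,2}$ and a bit $o_k\sim\mathrm{Bernoulli}(\mathbb T(\tau_{k,1},\tau_{k,2}))$. If $\pi^*\in\Pi$ satisfies $\mathbb T(\pi^*,\pi_0)\ge\frac12$ for all $\pi_0\in\Pi$,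 the regret is $Reg(K)=\sum_{k=1}^K\sum_{i=1}^2\big(\mathbb T(\pi^*,\pi_{k,i})-\tfrac12\big)$. Fix constants $B>1$ and $L,R>0$ with $LR>\frac12$. *Known features* of dimensions $(\tilde d_{\mathbb P},\tilde d_{\mathbb T})$ are maps $\phi:\mathcal S\times\mathcal A\times\mathcal S\to\mathbb R^{\tilde d_{\mathbb P}}$ with $\|\sum_{s'}\phi(s,a,s')V(s')\|_2\le1$ for all $s,a$ and all $V:\mathcal S\to[0,1]$, and $\psi:\mathrm{Traj}\times\mathrm{Traj}\to\mathbb R^{\tilde d_{\mathbb T}}$ with $\|\psi\|_2\le L$. A $\tilde d_{\mathbb P}$-dimensional linear mixture MDP with a $\tilde d_{\mathbb T}$-dimensional linear preference function over these features is given by unknown parameters $\theta_{\mathbb P},\theta_{\mathbb T}$ with $\|\theta_{\mathbb P}\|_2\le B$, $\|\theta_{\mathbb T}\|_2\le R$ such that $\mathbb P(s'\mid s,a)=\phi(s,a,s')^\top\theta_{\mathbb P}$ is a transition kernel and $\mathbb T(\tau_1,\tau_2)=\psi(\tau_1,\tau_2)^\top\theta_{\mathbb T}$ is a preference function. **Statement.**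 There is a constant $c>0$, depending only on $B,L,R$, such that for all integers $H\ge2$ and $\tilde d_{\mathbb P},\tilde d_{\mathbb T}\ge1$ with $\tilde d_{\mathbb P}+\tilde d_{\mathbb T}\ge3$ there are a finite $\mathcal S$, a finite nonempty $\mathcal A$, an initial state $s_1$ and known features $(\phi,\psi)$ of dimensions $(\tilde d_{\mathbb P},\tilde d_{\mathbb T})$ with the following property. For every $K\ge(\tilde d_{\mathbb P}+\tilde d_{\mathbb T})^2$ and every PbRL algorithm for $K$ episodes (which may depend on all of the above, but not on the unknown parameters) there is a linear mixture MDP with a linear preference function over these features that admits a $\pi^*$ as above and on which, for every such $\pi^*$, $$\mathbb E[Reg(K)]\ \ge\ c\,\big(\tilde d_{\mathbb P}\sqrt K+\tilde d_{\mathbb T}\sqrt K\big).$$ -/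

import Mathlib

open MeasureTheory

universe u

namespace PbRL

noncomputable section

/-- `H`-step trajectories `(s_1, a_1, …, s_H, a_H)`; position `h : Fin H` holds the
state-action pair of step `h + 1`. -/
abbrev Traj (S A : Type) (H : ℕ) : Type := Fin H → S × A

/-- A (time-homogeneous) transition kernel `S × A → Δ(S)` on a finite state space. -/
abbrev Transition (S A : Type) [Fintype S] : Type := S → A → stdSimplex ℝ S

/-- A randomized history-dependent policy: at each step it maps the earlier state-action pairs
and the current state to a probability distribution on the actions. -/
abbrev Policy (S A : Type) [Fintype A] (H : ℕ) : Type :=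
  (h : Fin H) → (Fin h → S × A) → S → stdSimplex ℝ A

/-- The first `k` entries of a sequence. -/
def before {X : Type} {n : ℕ} (x : Fin n → X) (k : Fin n) : Fin k → X :=
  fun i => x (i.castLE k.isLt.le)

open Classical in
/-- The probability of the state at step `h` of `τ` given the earlier part of `τ`: the first state
is `s₁`, the later ones follow the transition kernel. -/
def stateProb {S A : Type} [Fintype S] {H : ℕ} (P : Transition S A) (s₁ : S)
    (τ : Traj S A H) (h : Fin H) : ℝ :=
  if hh : (h : ℕ) = 0 then (if (τ h).1 = s₁ then 1 else 0)
  else (P (τ ⟨h - 1, by omega⟩).1 (τ ⟨h - 1, by omega⟩).2 : S → ℝ) (τ h).1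

/-- The probability of the trajectory `τ` when `π` is executed in the MDP with transition kernel
`P` and initial state `s₁`. -/
def trajProb {S A : Type} [Fintype S] [Fintype A] {H : ℕ} (P : Transition S A) (s₁ : S)
    (π : Policy S A H) (τ : Traj S A H) : ℝ :=
  ∏ h : Fin H, stateProb P s₁ τ h * (π h (before τ h) (τ h).1 : A → ℝ) (τ h).2

/-- `T τ₁ τ₂` (the probability that `τ₁` is preferred to `τ₂`) is a preference function. -/
def IsPreference {S A : Type} {H : ℕ} (T : Traj S A H → Traj S A H → ℝ) : Prop :=
  ∀ τ₁ τ₂, T τ₁ τ₂ ∈ Set.Icc (0 : ℝ) 1 ∧ T τ₁ τ₂ + T τ₂ τ₁ = 1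

/-- The preference between two policies: the expectation of `T τ₁ τ₂` for independent
trajectories `τ₁ ∼ (P, π₁)` and `τ₂ ∼ (P, π₂)`. -/
def policyPref {S A : Type} [Fintype S] [Fintype A] {H : ℕ} (P : Transition S A) (s₁ : S)
    (T : Traj S A H → Traj S A H → ℝ) (π₁ π₂ : Policy S A H) : ℝ :=
  ∑ τ₁, ∑ τ₂, trajProb P s₁ π₁ τ₁ * trajProb P s₁ π₂ τ₂ * T τ₁ τ₂

/-- `πstar` is preferred, at least weakly, to every history-dependent policy. -/
def IsOptimal {S A : Type} [Fintype S] [Fintype A] {H : ℕ} (P : Transition S A) (s₁ : S)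
    (T : Traj S A H → Traj S A H → ℝ) (πstar : Policy S A H) : Prop :=
  ∀ π₀ : Policy S A H, 1 / 2 ≤ policyPref P s₁ T πstar π₀

/-- What the agent observes in one episode: the two trajectories and the preference bit
(`true` when the first trajectory is preferred). -/
abbrev Feedback (S A : Type) (H : ℕ) : Type := Traj S A H × Traj S A H × Bool

/-- A randomized PbRL algorithm for `K` episodes: a random seed is drawn from some probability
space, and the two policies of each episode are a function of the seed and of the observations
made in the earlier episodes. -/
structure Algorithm (S A : Type) [Fintype A] (H K : ℕ) where
  /-- The space of seeds. -/
  Seed : Type u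
  /-- Its σ-algebra. -/
  [mSeed : MeasurableSpace Seed]
  /-- The distribution of the seed. -/
  law : Measure Seed
  [isProb : IsProbabilityMeasure law]
  /-- The two policies executed in episode `k`. -/
  policy : (k : Fin K) → (Fin k → Feedback S A H) → Seed → Fin 2 → Policy S A H
  measurable_policy : ∀ k D i h p s a,
    Measurable fun ω : Seed => (policy k D ω i h p s : A → ℝ) a

attribute [instance] Algorithm.mSeed Algorithm.isProb

/-- The probability of the observations `D` of all `K` episodes, given the seed `ω`. -/
def dataProb {S A : Type} [Fintype S] [Fintype A] {H K : ℕ} (P : Transition S A) (s₁ : S)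
    (T : Traj S A H → Traj S A H → ℝ) (alg : Algorithm.{u} S A H K) (ω : alg.Seed)
    (D : Fin K → Feedback S A H) : ℝ :=
  ∏ k : Fin K,
    trajProb P s₁ (alg.policy k (before D k) ω 0) (D k).1 *
    trajProb P s₁ (alg.policy k (before D k) ω 1) (D k).2.1 *
    (if (D k).2.2 = true then T (D k).1 (D k).2.1 else 1 - T (D k).1 (D k).2.1)

/-- The expectation, over the seed, the trajectories and the preference bits, of
`Reg(K) = ∑_{k = 1}^K ∑_{i = 1}^2 (T(πstar, π_{k, i}) - 1 / 2)`. The integrand is a bounded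
measurable function of the seed. -/
def expectedRegret {S A : Type} [Fintype S] [Fintype A] {H K : ℕ} (P : Transition S A) (s₁ : S)
    (T : Traj S A H → Traj S A H → ℝ) (πstar : Policy S A H)
    (alg : Algorithm.{u} S A H K) : ℝ :=
  ∫ ω, ∑ D : Fin K → Feedback S A H, dataProb P s₁ T alg ω D *
    ∑ k : Fin K, ∑ i : Fin 2,
      (policyPref P s₁ T πstar (alg.policy k (before D k) ω i) - 1 / 2) ∂alg.law

/-- Known feature maps: `φ` of a `dP`-dimensional linear mixture model and `ψ` of a
`dT`-dimensional linear preference model, the latter bounded by `L`. -/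
structure LinearFeatures (S A : Type) [Fintype S] (H dP dT : ℕ) (L : ℝ) where
  /-- The feature map of the transitions. -/
  φ : S → A → S → EuclideanSpace ℝ (Fin dP)
  norm_φ : ∀ s a (V : S → ℝ), (∀ s', V s' ∈ Set.Icc (0 : ℝ) 1) → ‖∑ s', V s' • φ s a s'‖ ≤ 1
  /-- The feature map of the preferences. -/
  ψ : Traj S A H → Traj S A H → EuclideanSpace ℝ (Fin dT)
  norm_ψ : ∀ τ₁ τ₂, ‖ψ τ₁ τ₂‖ ≤ L

/-- The unknown parameters of a linear mixture MDP with a linear preference function over the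
features `F`, with parameter norms at most `B` and `R`. -/
structure LinearInstance {S A : Type} [Fintype S] {H dP dT : ℕ} {L : ℝ}
    (F : LinearFeatures S A H dP dT L) (B R : ℝ) where
  /-- The parameter of the transitions. -/
  θP : EuclideanSpace ℝ (Fin dP)
  norm_θP : ‖θP‖ ≤ B
  isTransition : ∀ s a, (fun s' => inner ℝ (F.φ s a s') θP) ∈ stdSimplex ℝ S
  /-- The parameter of the preferences. -/
  θT : EuclideanSpace ℝ (Fin dT)
  norm_θT : ‖θT‖ ≤ R
  isPreference : IsPreference fun τ₁ τ₂ => inner ℝ (F.ψ τ₁ τ₂) θT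

/-- The transition kernel `P(s' | s, a) = φ(s, a, s')ᵀ θP`. -/
def LinearInstance.transition {S A : Type} [Fintype S] {H dP dT : ℕ} {L B R : ℝ}
    {F : LinearFeatures S A H dP dT L} (M : LinearInstance F B R) : Transition S A :=
  fun s a => ⟨fun s' => inner ℝ (F.φ s a s') M.θP, M.isTransition s a⟩

/-- The preference function `T(τ₁, τ₂) = ψ(τ₁, τ₂)ᵀ θT`. -/
def LinearInstance.pref {S A : Type} [Fintype S] {H dP dT : ℕ} {L B R : ℝ}
    {F : LinearFeatures S A H dP dT L} (M : LinearInstance F B R) :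
    Traj S A H → Traj S A H → ℝ :=
  fun τ₁ τ₂ => inner ℝ (F.ψ τ₁ τ₂) M.θT

end

end PbRL

namespace PbRL

noncomputable section

/-! ### Sequential laws and Bhattacharyya coefficients -/

/-- The probability of a sequence whose `k`-th entry has law `q k b` given the earlier part `b`. -/
def seqProb {X : Type} {n : ℕ} (q : (k : Fin n) → (Fin k → X) → X → ℝ) (x : Fin n → X) : ℝ :=
  ∏ k, q k (before x k) (x k)

theorem before_snoc_castSucc {X : Type} {n : ℕ} (y : Fin n → X) (z : X) (k : Fin n) :
    before (Fin.snoc y z : Fin (n + 1) → X) k.castSucc = before y k := by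
  funext i
  have : (i.castLE k.castSucc.isLt.le : Fin (n + 1)) = (i.castLE k.isLt.le : Fin n).castSucc := rfl
  simp only [before]
  rw [this]
  exact Fin.snoc_castSucc (α := fun _ => X) z y _

theorem before_snoc_last {X : Type} {n : ℕ} (y : Fin n → X) (z : X) :
    before (Fin.snoc y z : Fin (n + 1) → X) (Fin.last n) = y := by
  funext i
  exact Fin.snoc_castSucc (α := fun _ => X) z y i

theorem seqProb_snoc {X : Type} {n : ℕ} (q : (k : Fin (n + 1)) → (Fin k → X) → X → ℝ)
    (y : Fin n → X) (z : X) :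
    seqProb q (Fin.snoc y z : Fin (n + 1) → X) =
      seqProb (fun k : Fin n => q k.castSucc) y * q (Fin.last n) y z := by
  unfold seqProb
  rw [Fin.prod_univ_castSucc, before_snoc_last, Fin.snoc_last]
  congr 1
  refine Finset.prod_congr rfl fun k _ => ?_
  rw [before_snoc_castSucc, Fin.snoc_castSucc]

theorem sum_fin_succ_fun {X : Type} [Fintype X] {n : ℕ} (F : (Fin (n + 1) → X) → ℝ) :
    ∑ x, F x = ∑ y : Fin n → X, ∑ z, F (Fin.snoc y z : Fin (n + 1) → X) := by
  rw [← (Fin.snocEquiv fun _ => X).sum_comp, Fintype.sum_prod_type, Finset.sum_comm]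
  rfl

theorem seqProb_nonneg {X : Type} {n : ℕ} {q : (k : Fin n) → (Fin k → X) → X → ℝ}
    (hq : ∀ k b x, 0 ≤ q k b x) (x : Fin n → X) : 0 ≤ seqProb q x :=
  Finset.prod_nonneg fun _ _ => hq _ _ _

/-- The expectation of a function of the first `m` entries. -/
theorem sum_seqProb_mul_castLE {X : Type} [Fintype X] {m n : ℕ} (hmn : m ≤ n)
    (q : (k : Fin n) → (Fin k → X) → X → ℝ) (hq : ∀ k b, ∑ x, q k b x = 1)
    (f : (Fin m → X) → ℝ) :
    ∑ x, seqProb q x * f (fun i => x (i.castLE hmn)) =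
      ∑ y, seqProb (fun k : Fin m => q (k.castLE hmn)) y * f y := by
  induction n with
  | zero =>
    obtain rfl : m = 0 := by omega
    rfl
  | succ n ih =>
    rcases hmn.eq_or_lt with rfl | hlt
    · rfl
    · have hmn' : m ≤ n := by omega
      rw [sum_fin_succ_fun]
      refine Eq.trans ?_ (ih hmn' (fun k : Fin n => q k.castSucc) fun k b => hq k.castSucc b)
      refine Finset.sum_congr rfl fun y _ => ?_
      have h1 : ∀ z, (fun i : Fin m => (Fin.snoc y z : Fin (n + 1) → X) (i.castLE hmn)) =
          fun i => y (i.castLE hmn') := fun z => by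
        funext i
        exact Fin.snoc_castSucc (α := fun _ => X) z y (i.castLE hmn')
      simp only [seqProb_snoc, h1]
      rw [← Finset.sum_mul, ← Finset.mul_sum, hq (Fin.last n) y, mul_one]

theorem sum_seqProb {X : Type} [Fintype X] {n : ℕ}
    (q : (k : Fin n) → (Fin k → X) → X → ℝ) (hq : ∀ k b, ∑ x, q k b x = 1) :
    ∑ x, seqProb q x = 1 := by
  have := sum_seqProb_mul_castLE (Nat.zero_le n) q hq fun _ => 1
  simpa [seqProb] using this

/-- The Bhattacharyya coefficient of two sequential laws is at least the product of lower bounds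
for those of their steps. -/
theorem prod_le_sum_sqrt_seqProb {X : Type} [Fintype X] {n : ℕ}
    (q r : (k : Fin n) → (Fin k → X) → X → ℝ)
    (hq : ∀ k b x, 0 ≤ q k b x) (hr : ∀ k b x, 0 ≤ r k b x) (ρ : Fin n → ℝ) (hρ : ∀ k, 0 ≤ ρ k)
    (h : ∀ (k : Fin n) (b : Fin k → X),
      seqProb (fun i : Fin k => q (i.castLE k.isLt.le)) b ≠ 0 →
      ρ k ≤ ∑ x, √(q k b x * r k b x)) :
    ∏ k, ρ k ≤ ∑ x, √(seqProb q x * seqProb r x) := by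
  induction n with
  | zero => simp [seqProb]
  | succ n ih =>
    rw [sum_fin_succ_fun, Fin.prod_univ_castSucc]
    have ih' := ih (fun k : Fin n => q k.castSucc) (fun k : Fin n => r k.castSucc)
      (fun k => hq k.castSucc) (fun k => hr k.castSucc) (fun k => ρ k.castSucc)
      (fun k => hρ _) (fun k b hb => h k.castSucc b hb)
    refine (mul_le_mul_of_nonneg_right ih' (hρ _)).trans ?_
    rw [Finset.sum_mul]
    refine Finset.sum_le_sum fun y _ => ?_
    have hs : ∀ z, √(seqProb q (Fin.snoc y z : Fin (n + 1) → X) *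
        seqProb r (Fin.snoc y z : Fin (n + 1) → X)) =
        √(seqProb (fun k : Fin n => q k.castSucc) y * seqProb (fun k : Fin n => r k.castSucc) y) *
        √(q (Fin.last n) y z * r (Fin.last n) y z) := fun z => by
      rw [seqProb_snoc, seqProb_snoc, ← Real.sqrt_mul (mul_nonneg
        (seqProb_nonneg (fun k => hq k.castSucc) y) (seqProb_nonneg (fun k => hr k.castSucc) y))]
      congr 1
      ring
    simp only [hs]
    rw [← Finset.mul_sum]
    -- Histories of zero `q`-probability contribute nothing, so the one-step bound is needed only on
    -- reachable histories. This is what later excludes returns to the initial state.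
    by_cases h0 : seqProb (fun k : Fin n => q k.castSucc) y = 0
    · simp [h0]
    · exact mul_le_mul_of_nonneg_left (h (Fin.last n) y h0) (Real.sqrt_nonneg _)

/-- The overlap of two probability vectors in terms of their Bhattacharyya coefficient. -/
theorem sq_div_two_le_sum_min {D : Type} [Fintype D] {p q : D → ℝ} (hp : ∀ x, 0 ≤ p x)
    (hq : ∀ x, 0 ≤ q x) (hp1 : ∑ x, p x = 1) (hq1 : ∑ x, q x = 1) {ρ : ℝ} (hρ : 0 ≤ ρ)
    (h : ρ ≤ ∑ x, √(p x * q x)) : ρ ^ 2 / 2 ≤ ∑ x, min (p x) (q x) := by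
  -- Cauchy–Schwarz for the factorization `√(p * q) = √(min p q) * √(max p q)`; the maxima sum to at
  -- most `2`.
  have h1 : (∑ x, √(min (p x) (q x)) * √(max (p x) (q x))) ^ 2 ≤
      (∑ x, √(min (p x) (q x)) ^ 2) * ∑ x, √(max (p x) (q x)) ^ 2 :=
    Finset.sum_mul_sq_le_sq_mul_sq _ _ _
  have h2 : ∀ x, √(min (p x) (q x)) * √(max (p x) (q x)) = √(p x * q x) := fun x => by
    rw [← Real.sqrt_mul (le_min (hp x) (hq x)), min_mul_max]
  have h3 : ∀ x, √(min (p x) (q x)) ^ 2 = min (p x) (q x) := fun x =>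
    Real.sq_sqrt (le_min (hp x) (hq x))
  have h4 : ∀ x, √(max (p x) (q x)) ^ 2 = max (p x) (q x) := fun x =>
    Real.sq_sqrt (le_max_of_le_left (hp x))
  simp only [h2, h3, h4] at h1
  have h5 : ∑ x, max (p x) (q x) ≤ 2 := by
    calc ∑ x, max (p x) (q x) ≤ ∑ x, (p x + q x) :=
          Finset.sum_le_sum fun x _ =>
            max_le (le_add_of_nonneg_right (hq x)) (le_add_of_nonneg_left (hp x))
      _ = 2 := by rw [Finset.sum_add_distrib, hp1, hq1]; norm_num
  have h6 : 0 ≤ ∑ x, min (p x) (q x) := Finset.sum_nonneg fun x _ => le_min (hp x) (hq x)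
  have h7 : ρ ^ 2 ≤ (∑ x, √(p x * q x)) ^ 2 := pow_le_pow_left₀ hρ h 2
  nlinarith [mul_le_mul_of_nonneg_left h5 h6]

/-- The Bhattacharyya coefficient of two Bernoulli laws with parameters in `[1/4, 3/4]`. -/
theorem one_sub_sq_le_sqrt_add_sqrt {p q : ℝ} (hp : p ∈ Set.Icc (1 / 4 : ℝ) (3 / 4))
    (hq : q ∈ Set.Icc (1 / 4 : ℝ) (3 / 4)) :
    1 - (p - q) ^ 2 ≤ √(p * q) + √((1 - p) * (1 - q)) := by
  -- The gap between arithmetic and geometric mean is `(√a - √b) ^ 2 / 2`. Since `√a + √b ≥ 1`, it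
  -- is at most `(a - b) ^ 2 / 2`.
  have key : ∀ {a b : ℝ}, 1 / 4 ≤ a → 1 / 4 ≤ b → (a + b) / 2 - (a - b) ^ 2 / 2 ≤ √(a * b) := by
    intro a b ha hb
    have ha' : 1 / 2 ≤ √a := Real.le_sqrt_of_sq_le (by linarith)
    have hb' : 1 / 2 ≤ √b := Real.le_sqrt_of_sq_le (by linarith)
    rw [Real.sqrt_mul (by linarith)]
    have e1 : √a ^ 2 = a := Real.sq_sqrt (by linarith)
    have e2 : √b ^ 2 = b := Real.sq_sqrt (by linarith)
    set x := √a
    set y := √b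
    rw [← e1, ← e2]
    have h1 : 1 ≤ (x + y) ^ 2 := by nlinarith
    nlinarith [mul_le_mul_of_nonneg_left h1 (sq_nonneg (x - y))]
  have h1 := key hp.1 hq.1
  have h2 := key (a := 1 - p) (b := 1 - q) (by linarith [hp.2]) (by linarith [hq.2])
  nlinarith

/-! ### Bit flips and Assouad's lemma -/

/-- The vector `θ` with its `j`-th bit flipped. -/
def flipBit {d : ℕ} (j : Fin d) (θ : Fin d → Bool) : Fin d → Bool :=
  Function.update θ j (!θ j)

theorem flipBit_self {d : ℕ} (j : Fin d) (θ : Fin d → Bool) : flipBit j θ j = !θ j := by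
  simp [flipBit]

theorem flipBit_of_ne {d : ℕ} {j i : Fin d} (h : i ≠ j) (θ : Fin d → Bool) :
    flipBit j θ i = θ i := by
  simp [flipBit, h]

theorem flipBit_involutive {d : ℕ} (j : Fin d) : Function.Involutive (flipBit j) := by
  intro θ
  funext i
  by_cases h : i = j
  · subst h; simp [flipBit_self]
  · simp [flipBit_of_ne h]

/-- Assouad's lemma. -/
theorem assouad {D : Type} [Fintype D] {d : ℕ} (p : (Fin d → Bool) → D → ℝ) (μ W : ℝ)
    (hμ : ∀ θ j, μ ≤ ∑ x, min (p θ x) (p (flipBit j θ) x))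
    (l : Fin d → D → Bool → ℝ) (hl : ∀ j x b, 0 ≤ l j x b) (hW : 0 ≤ W)
    (hlW : ∀ j x, l j x true + l j x false = W) :
    2 ^ d * (d * (μ * W / 2)) ≤ ∑ θ, ∑ x, p θ x * ∑ j, l j x (θ j) := by
  have h1 : ∑ θ, ∑ x, p θ x * ∑ j, l j x (θ j) = ∑ j, ∑ θ, ∑ x, p θ x * l j x (θ j) := by
    simp only [Finset.mul_sum]
    rw [Finset.sum_comm (s := Finset.univ (α := Fin d))]
    exact Finset.sum_congr rfl fun θ _ => Finset.sum_comm
  have h2 : ∀ j, 2 ^ d * (μ * W / 2) ≤ ∑ θ, ∑ x, p θ x * l j x (θ j) := by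
    intro j
    have e := Equiv.sum_comp (flipBit_involutive j).toPerm fun θ => ∑ x, p θ x * l j x (θ j)
    -- For the same observation `x`, the losses of `θ` and of its flip add up to `W`, and both laws
    -- give `x` at least the mass of their minimum. Flipping is a bijection, so summing over `θ`
    -- counts each loss twice.
    have h3 : ∀ θ, μ * W ≤ ∑ x, p θ x * l j x (θ j) +
        ∑ x, p (flipBit j θ) x * l j x (flipBit j θ j) := by
      intro θ
      refine (mul_le_mul_of_nonneg_right (hμ θ j) hW).trans ?_
      rw [Finset.sum_mul, ← Finset.sum_add_distrib]
      refine Finset.sum_le_sum fun x _ => ?_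
      have hs : l j x (θ j) + l j x (flipBit j θ j) = W := by
        rw [flipBit_self, ← hlW j x]
        cases θ j
        · exact add_comm _ _
        · rfl
      rw [← hs, mul_add]
      exact add_le_add (mul_le_mul_of_nonneg_right (min_le_left _ _) (hl _ _ _))
        (mul_le_mul_of_nonneg_right (min_le_right _ _) (hl _ _ _))
    have h4 := Finset.sum_le_sum fun θ (_ : θ ∈ Finset.univ) => h3 θ
    rw [Finset.sum_add_distrib] at h4
    have e' : ∑ θ, ∑ x, p (flipBit j θ) x * l j x (flipBit j θ j) =
        ∑ θ, ∑ x, p θ x * l j x (θ j) := e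
    rw [e'] at h4
    simp only [Finset.sum_const, Finset.card_univ, Fintype.card_pi, Fintype.card_bool,
      Finset.prod_const, Fintype.card_fin, nsmul_eq_mul] at h4
    push_cast at h4
    linarith
  rw [h1]
  calc (2 : ℝ) ^ d * (d * (μ * W / 2)) = ∑ _j : Fin d, 2 ^ d * (μ * W / 2) := by
        simp; ring
    _ ≤ _ := Finset.sum_le_sum fun j _ => h2 j

/-! ### Laws of trajectories and of episodes -/

open Classical in
/-- The law of the state-action pair at step `h`, given the earlier pairs. -/
def stepProb {S A : Type} [Fintype S] [Fintype A] {H : ℕ} (P : Transition S A) (s₁ : S)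
    (π : Policy S A H) (h : Fin H) (b : Fin h → S × A) (x : S × A) : ℝ :=
  (if hh : (h : ℕ) = 0 then (if x.1 = s₁ then 1 else 0)
    else (P (b ⟨h - 1, by omega⟩).1 (b ⟨h - 1, by omega⟩).2 : S → ℝ) x.1) *
  (π h b x.1 : A → ℝ) x.2

section Trajectories

theorem sum_stdSimplex {X : Type} [Fintype X] (p : stdSimplex ℝ X) : ∑ x, (p : X → ℝ) x = 1 :=
  p.2.2

theorem stdSimplex_apply_nonneg {X : Type} [Fintype X] (p : stdSimplex ℝ X) (x : X) :
    0 ≤ (p : X → ℝ) x := p.2.1 x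

theorem sum_seqProb_two {X : Type} [Fintype X] (q : (k : Fin 2) → (Fin k → X) → X → ℝ)
    (F : X → X → ℝ) :
    ∑ y, seqProb q y * F (y 0) (y 1) =
      ∑ x, q 0 (fun i => Fin.elim0 i) x * ∑ z, q 1 (fun _ => x) z * F x z := by
  rw [← (finTwoArrowEquiv X).symm.sum_comp, Fintype.sum_prod_type]
  refine Finset.sum_congr rfl fun x _ => ?_
  rw [Finset.mul_sum]
  refine Finset.sum_congr rfl fun z _ => ?_
  have h0 : before ![x, z] 0 = fun i => Fin.elim0 i := by
    funext i
    exact Fin.elim0 i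
  have h1 : before ![x, z] 1 = fun _ => x := by
    funext i
    have : (i.castLE (1 : Fin 2).isLt.le : Fin 2) = 0 := by
      ext
      have := i.2
      simp only [Fin.val_one] at this
      simp
    rw [before, this]
    rfl
  simp only [finTwoArrowEquiv_symm_apply, seqProb, Fin.prod_univ_two, h0, h1]
  simp [mul_assoc]

section FirstAction

variable {S A : Type} [Fintype A] {H : ℕ} (s₁ : S)

/-- The law of the first action. -/
def firstAction (hH : 0 < H) (π : Policy S A H) (a : A) : ℝ :=
  (π ⟨0, hH⟩ (fun i => Fin.elim0 i) s₁ : A → ℝ) a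

theorem firstAction_nonneg (hH : 0 < H) (π : Policy S A H) (a : A) :
    0 ≤ firstAction s₁ hH π a := (π ⟨0, hH⟩ _ s₁).2.1 a

theorem sum_firstAction (hH : 0 < H) (π : Policy S A H) :
    ∑ a, firstAction s₁ hH π a = 1 := (π ⟨0, hH⟩ _ s₁).2.2

end FirstAction

variable {S A : Type} [Fintype S] [Fintype A] {H : ℕ} (P : Transition S A) (s₁ : S)

theorem stepProb_nonneg (π : Policy S A H) (h : Fin H) (b : Fin h → S × A) (x : S × A) :
    0 ≤ stepProb P s₁ π h b x := by
  unfold stepProb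
  refine mul_nonneg ?_ ((π h b x.1).2.1 _)
  split_ifs
  · exact zero_le_one
  · exact le_rfl
  · exact (P _ _).2.1 _

theorem sum_stepProb (π : Policy S A H) (h : Fin H) (b : Fin h → S × A) :
    ∑ x, stepProb P s₁ π h b x = 1 := by
  have h1 : ∀ c : S → ℝ, ∑ s, ∑ a, c s * (π h b s : A → ℝ) a = ∑ s, c s := fun c => by
    simp only [← Finset.mul_sum, sum_stdSimplex, mul_one]
  unfold stepProb
  rw [Fintype.sum_prod_type]
  by_cases hh : (h : ℕ) = 0
  · classical
    refine Eq.trans ?_ ((h1 fun s => if s = s₁ then 1 else 0).trans (by simp))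
    simp [hh]
  · refine Eq.trans ?_ ((h1 _).trans
      (sum_stdSimplex (P (b ⟨h - 1, by omega⟩).1 (b ⟨h - 1, by omega⟩).2)))
    simp only [hh, dite_false]

/-- `trajProb` is definitionally `seqProb` of `stepProb`, as `dataProb` is of `episodeProb` once the
seed is fixed; facts about sequential laws thus apply at both levels. -/
theorem trajProb_nonneg (π : Policy S A H) (τ : Traj S A H) : 0 ≤ trajProb P s₁ π τ :=
  seqProb_nonneg (stepProb_nonneg P s₁ π) τ

theorem sum_trajProb (π : Policy S A H) : ∑ τ, trajProb P s₁ π τ = 1 :=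
  sum_seqProb _ (sum_stepProb P s₁ π)

/-- The expectation of a function of the first action and the second state. -/
theorem sum_trajProb_mul (hH : 2 ≤ H) (π : Policy S A H) (f : S × A → S → ℝ) :
    ∑ τ, trajProb P s₁ π τ * f (τ ⟨0, by omega⟩) (τ ⟨1, by omega⟩).1 =
      ∑ a, firstAction s₁ (by omega) π a * ∑ s, (P s₁ a : S → ℝ) s * f (s₁, a) s := by
  have h := sum_seqProb_mul_castLE hH (stepProb P s₁ π) (sum_stepProb P s₁ π)
    fun y => f (y 0) (y 1).1
  refine h.trans ?_
  rw [sum_seqProb_two _ fun x z => f x z.1, Fintype.sum_prod_type, Finset.sum_eq_single s₁]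
  · refine Finset.sum_congr rfl fun a _ => ?_
    have h0 : stepProb P s₁ π (Fin.castLE hH 0) (fun i => Fin.elim0 i) (s₁, a) =
        firstAction s₁ (by omega) π a := by
      simp only [stepProb, Fin.val_castLE, Fin.val_zero, dite_true, if_true, one_mul]
      rfl
    refine congrArg₂ (· * ·) h0 ?_
    rw [Fintype.sum_prod_type]
    refine Finset.sum_congr rfl fun s _ => ?_
    refine (Finset.sum_mul Finset.univ _ (f (s₁, a) s)).symm.trans ?_
    congr 1
    have h1 : ∀ a', stepProb P s₁ π (Fin.castLE hH 1) (fun _ => (s₁, a)) (s, a') =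
        (P s₁ a : S → ℝ) s * (π (Fin.castLE hH 1) (fun _ => (s₁, a)) s : A → ℝ) a' := fun a' => by
      simp [stepProb]
    refine (Finset.sum_congr rfl fun a' _ => h1 a').trans ?_
    rw [← Finset.mul_sum, sum_stdSimplex, mul_one]
  · intro s _ hs
    refine Finset.sum_eq_zero fun a _ => ?_
    simp [stepProb, hs]
  · simp

/-- The law of the observations in one episode. -/
def episodeProb (T : Traj S A H → Traj S A H → ℝ) (π₁ π₂ : Policy S A H)
    (x : Feedback S A H) : ℝ :=
  trajProb P s₁ π₁ x.1 * trajProb P s₁ π₂ x.2.1 *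
    (if x.2.2 = true then T x.1 x.2.1 else 1 - T x.1 x.2.1)

variable {P s₁} {T : Traj S A H → Traj S A H → ℝ}

theorem episodeProb_nonneg (hT : IsPreference T) (π₁ π₂ : Policy S A H) (x : Feedback S A H) :
    0 ≤ episodeProb P s₁ T π₁ π₂ x := by
  refine mul_nonneg (mul_nonneg (trajProb_nonneg P s₁ _ _) (trajProb_nonneg P s₁ _ _)) ?_
  have := (hT x.1 x.2.1).1
  split_ifs
  · exact this.1
  · linarith [this.2]

theorem sum_episodeProb (π₁ π₂ : Policy S A H) : ∑ x, episodeProb P s₁ T π₁ π₂ x = 1 := by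
  simp only [episodeProb, Fintype.sum_prod_type, Fintype.sum_bool, if_true, Bool.false_eq_true,
    if_false, ← mul_add, add_sub_cancel, mul_one]
  simp only [← Finset.mul_sum, sum_trajProb, mul_one]

variable {K : ℕ}

theorem dataProb_nonneg (hT : IsPreference T) (alg : Algorithm.{u} S A H K) (ω : alg.Seed)
    (D : Fin K → Feedback S A H) : 0 ≤ dataProb P s₁ T alg ω D :=
  seqProb_nonneg (fun _ _ _ => episodeProb_nonneg hT _ _ _) D

theorem sum_dataProb (alg : Algorithm.{u} S A H K) (ω : alg.Seed) :
    ∑ D, dataProb P s₁ T alg ω D = 1 :=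
  sum_seqProb (fun k b x => episodeProb P s₁ T (alg.policy k b ω 0) (alg.policy k b ω 1) x)
    fun _ _ => sum_episodeProb _ _

theorem measurable_trajProb (alg : Algorithm.{u} S A H K) (k : Fin K)
    (b : Fin k → Feedback S A H) (i : Fin 2) (τ : Traj S A H) :
    Measurable fun ω => trajProb P s₁ (alg.policy k b ω i) τ := by
  unfold trajProb
  exact Finset.measurable_prod _ fun h _ =>
    (alg.measurable_policy k b i h (before τ h) (τ h).1 (τ h).2).const_mul _

theorem measurable_dataProb (alg : Algorithm.{u} S A H K) (D : Fin K → Feedback S A H) :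
    Measurable fun ω => dataProb P s₁ T alg ω D := by
  unfold dataProb
  exact Finset.measurable_prod _ fun k _ =>
    ((measurable_trajProb alg k _ 0 _).mul (measurable_trajProb alg k _ 1 _)).mul_const _

/-- The preference between two policies when the preference between two trajectories is a
difference of utilities. -/
theorem policyPref_eq {g : Traj S A H → ℝ} (hT : ∀ τ₁ τ₂, T τ₁ τ₂ = 1 / 2 + g τ₁ - g τ₂)
    (π₁ π₂ : Policy S A H) :
    policyPref P s₁ T π₁ π₂ =
      1 / 2 + ∑ τ, trajProb P s₁ π₁ τ * g τ - ∑ τ, trajProb P s₁ π₂ τ * g τ := by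
  have h : ∀ τ₁ τ₂, trajProb P s₁ π₁ τ₁ * trajProb P s₁ π₂ τ₂ * T τ₁ τ₂ =
      trajProb P s₁ π₁ τ₁ * (1 / 2 + g τ₁) * trajProb P s₁ π₂ τ₂ -
      trajProb P s₁ π₁ τ₁ * (trajProb P s₁ π₂ τ₂ * g τ₂) := fun τ₁ τ₂ => by
    rw [hT]; ring
  simp only [policyPref, h, Finset.sum_sub_distrib, ← Finset.mul_sum, ← Finset.sum_mul,
    sum_trajProb, mul_one, one_mul]
  simp only [mul_add, Finset.sum_add_distrib, ← Finset.sum_mul, sum_trajProb, one_mul]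

end Trajectories

/-! ### From wrong bits to regret -/

section Assouad

variable {S : Type} {d H K : ℕ}

/-- The probability that the `j`-th bit of the first action differs from `b`. -/
def bitError (s₁ : S) (hH : 0 < H) (π : Policy S (Fin d → Bool) H) (j : Fin d) (b : Bool) : ℝ :=
  ∑ a, firstAction s₁ hH π a * if a j = b then 0 else 1

theorem bitError_nonneg (s₁ : S) (hH : 0 < H) (π : Policy S (Fin d → Bool) H) (j : Fin d)
    (b : Bool) : 0 ≤ bitError s₁ hH π j b :=
  Finset.sum_nonneg fun a _ => mul_nonneg (firstAction_nonneg s₁ hH π a) (by split_ifs <;> simp)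

theorem bitError_add (s₁ : S) (hH : 0 < H) (π : Policy S (Fin d → Bool) H) (j : Fin d) :
    bitError s₁ hH π j true + bitError s₁ hH π j false = 1 := by
  rw [bitError, bitError, ← Finset.sum_add_distrib]
  refine Eq.trans ?_ (sum_firstAction s₁ hH π)
  refine Finset.sum_congr rfl fun a _ => ?_
  cases a j <;> simp

/-- The policy that always plays `a`. -/
def constPolicy (a : Fin d → Bool) : Policy S (Fin d → Bool) H :=
  fun _ _ _ => ⟨Pi.single a 1, single_mem_stdSimplex ℝ a⟩

theorem bitError_constPolicy (s₁ : S) (hH : 0 < H) (θ : Fin d → Bool) (j : Fin d) :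
    bitError s₁ hH (constPolicy θ) j (θ j) = 0 := by
  refine Finset.sum_eq_zero fun a _ => ?_
  by_cases h : a = θ
  · simp [h]
  · simp [firstAction, constPolicy, h]

/-- The expected number of times that the `j`-th bit of a first action differs from `b`, when the
policies are chosen from the observations `D`. -/
def totalBitError (s₁ : S) (hH : 0 < H) (alg : Algorithm.{u} S (Fin d → Bool) H K) (ω : alg.Seed)
    (D : Fin K → Feedback S (Fin d → Bool) H) (j : Fin d) (b : Bool) : ℝ :=
  ∑ k : Fin K, ∑ i : Fin 2, bitError s₁ hH (alg.policy k (before D k) ω i) j b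

section

variable (s₁ : S) (hH : 0 < H) (alg : Algorithm.{u} S (Fin d → Bool) H K) (ω : alg.Seed)
  (D : Fin K → Feedback S (Fin d → Bool) H) (j : Fin d)

theorem totalBitError_nonneg (b : Bool) : 0 ≤ totalBitError s₁ hH alg ω D j b :=
  Finset.sum_nonneg fun _ _ => Finset.sum_nonneg fun _ _ => bitError_nonneg _ _ _ _ _

theorem totalBitError_add :
    totalBitError s₁ hH alg ω D j true + totalBitError s₁ hH alg ω D j false = K * 2 := by
  simp only [totalBitError, ← Finset.sum_add_distrib, bitError_add]
  simp

theorem totalBitError_le (b : Bool) : totalBitError s₁ hH alg ω D j b ≤ K * 2 := by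
  have h := totalBitError_add s₁ hH alg ω D j
  have h1 := totalBitError_nonneg s₁ hH alg ω D j true
  have h2 := totalBitError_nonneg s₁ hH alg ω D j false
  cases b <;> linarith

theorem measurable_totalBitError (b : Bool) :
    Measurable fun ω => totalBitError s₁ hH alg ω D j b := by
  unfold totalBitError bitError firstAction
  refine Finset.measurable_sum _ fun k _ => Finset.measurable_sum _ fun i _ =>
    Finset.measurable_sum _ fun a _ => ?_
  exact (alg.measurable_policy k _ i _ _ _ _).mul_const _

variable [Fintype S] (P : Transition S (Fin d → Bool))
  {T : Traj S (Fin d → Bool) H → Traj S (Fin d → Bool) H → ℝ} (θ : Fin d → Bool)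

/-- The expected number of bits of first actions that differ from those of `θ`, given the seed. -/
def expectedErrors (T : Traj S (Fin d → Bool) H → Traj S (Fin d → Bool) H → ℝ) : ℝ :=
  ∑ D, dataProb P s₁ T alg ω D * ∑ j, totalBitError s₁ hH alg ω D j (θ j)

/-- Needed to exchange the seed integral with the finite sum over `θ` and to compare integrals. -/
theorem integrable_expectedErrors (hT : IsPreference T) :
    Integrable (fun ω => expectedErrors s₁ hH alg ω P θ T) alg.law := by
  have hmeas : Measurable (fun ω => expectedErrors s₁ hH alg ω P θ T) := by
    unfold expectedErrors
    exact Finset.measurable_sum _ fun D _ => (measurable_dataProb alg D).mul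
      (Finset.measurable_sum _ fun j _ => measurable_totalBitError s₁ hH alg D j _)
  refine Integrable.of_bound hmeas.aestronglyMeasurable (d * (K * 2))
    (Filter.Eventually.of_forall fun ω => ?_)
  have h0 : 0 ≤ expectedErrors s₁ hH alg ω P θ T := Finset.sum_nonneg fun D _ =>
    mul_nonneg (dataProb_nonneg hT alg ω D)
      (Finset.sum_nonneg fun j _ => totalBitError_nonneg _ _ _ _ _ _ _)
  rw [Real.norm_of_nonneg h0]
  calc expectedErrors s₁ hH alg ω P θ T ≤ ∑ D, dataProb P s₁ T alg ω D * (d * (K * 2)) := by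
        refine Finset.sum_le_sum fun D _ =>
          mul_le_mul_of_nonneg_left ?_ (dataProb_nonneg hT alg ω D)
        calc ∑ j, totalBitError s₁ hH alg ω D j (θ j) ≤ ∑ _j : Fin d, (K * 2 : ℝ) :=
              Finset.sum_le_sum fun j _ => totalBitError_le _ _ _ _ _ _ _
          _ = d * (K * 2) := by simp
    _ = d * (K * 2) := by rw [← Finset.sum_mul, sum_dataProb, one_mul]

end

/-- A regret lower bound for a family of instances, indexed by bit vectors, in which the regret of
a policy is proportional to the expected number of wrong bits of its first action, and in which
one episode hardly distinguishes between instances that differ in a single bit. -/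
theorem exists_le_expectedRegret [Fintype S] (hH : 0 < H) (s₁ : S)
    (P : (Fin d → Bool) → Transition S (Fin d → Bool))
    (T : (Fin d → Bool) → Traj S (Fin d → Bool) H → Traj S (Fin d → Bool) H → ℝ)
    (g : (Fin d → Bool) → Traj S (Fin d → Bool) H → ℝ) (hT : ∀ θ, IsPreference (T θ))
    (hg : ∀ θ τ₁ τ₂, T θ τ₁ τ₂ = 1 / 2 + g θ τ₁ - g θ τ₂) {C η ε : ℝ} (hη : 0 ≤ η)
    (hval : ∀ θ π, ∑ τ, trajProb (P θ) s₁ π τ * g θ τ =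
      C - η * ∑ j, bitError s₁ hH π j (θ j))
    (haff : ∀ θ j π₁ π₂, 1 - ε ≤ ∑ x, √(episodeProb (P θ) s₁ (T θ) π₁ π₂ x *
      episodeProb (P (flipBit j θ)) s₁ (T (flipBit j θ)) π₁ π₂ x))
    (hε : ε ≤ 1) (hKε : K * ε ≤ 1 / 2) (alg : Algorithm.{u} S (Fin d → Bool) H K) :
    ∃ θ, (∃ πstar, IsOptimal (P θ) s₁ (T θ) πstar) ∧
      ∀ πstar, IsOptimal (P θ) s₁ (T θ) πstar →
        η * (d * K / 8) ≤ expectedRegret (P θ) s₁ (T θ) πstar alg := by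
  -- Assouad's lemma is applied with the seed fixed, which makes the algorithm deterministic. The
  -- overlap `1 / 8` is `(1 / 2) ^ 2 / 2`, and `K * 2` counts the policies executed.
  have hsum : ∀ ω, 2 ^ d * (d * (1 / 8 * (K * 2) / 2)) ≤
      ∑ θ, expectedErrors s₁ hH alg ω (P θ) θ (T θ) := fun ω => by
    refine assouad (fun θ D => dataProb (P θ) s₁ (T θ) alg ω D) (1 / 8) (K * 2) (fun θ j => ?_)
      (fun j D b => totalBitError s₁ hH alg ω D j b)
      (fun _ _ _ => totalBitError_nonneg _ _ _ _ _ _ _) (by positivity)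
      fun _ _ => totalBitError_add _ _ _ _ _ _
    -- Bernoulli's inequality: `(1 - ε) ^ K ≥ 1 - K * ε`.
    have hρ : (1 / 2 : ℝ) ≤ (1 - ε) ^ K := by
      have := one_add_mul_le_pow (a := -ε) (by linarith) K
      rw [← sub_eq_add_neg] at this
      linarith
    have hBC : ∏ _k : Fin K, (1 - ε) ≤ ∑ D, √(dataProb (P θ) s₁ (T θ) alg ω D *
        dataProb (P (flipBit j θ)) s₁ (T (flipBit j θ)) alg ω D) :=
      prod_le_sum_sqrt_seqProb
        (fun k b x => episodeProb (P θ) s₁ (T θ) (alg.policy k b ω 0) (alg.policy k b ω 1) x)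
        (fun k b x => episodeProb (P (flipBit j θ)) s₁ (T (flipBit j θ))
          (alg.policy k b ω 0) (alg.policy k b ω 1) x)
        (fun _ _ _ => episodeProb_nonneg (hT _) _ _ _)
        (fun _ _ _ => episodeProb_nonneg (hT _) _ _ _) _ (fun _ => by linarith)
        fun k b _ => haff θ j _ _
    rw [Finset.prod_const, Finset.card_univ, Fintype.card_fin] at hBC
    have := sq_div_two_le_sum_min (dataProb_nonneg (hT θ) alg ω)
      (dataProb_nonneg (hT (flipBit j θ)) alg ω) (sum_dataProb alg ω) (sum_dataProb alg ω)
      (by norm_num : (0 : ℝ) ≤ 1 / 2) (hρ.trans hBC)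
    exact le_trans (by norm_num) this
  -- After integrating over the seed, the mean over the `2 ^ d` sign vectors is at least `d * K /
  -- 8`, so some `θ` independent of the seed reaches it.
  obtain ⟨θ, hθ⟩ : ∃ θ, d * K / 8 ≤ ∫ ω, expectedErrors s₁ hH alg ω (P θ) θ (T θ) ∂alg.law := by
    by_contra! hcon
    have hint := fun θ => integrable_expectedErrors s₁ hH alg (P θ) θ (hT θ)
    have h1 := Finset.sum_lt_sum_of_nonempty (Finset.univ_nonempty (α := Fin d → Bool))
      fun θ _ => hcon θ
    rw [← integral_finsetSum _ fun θ _ => hint θ] at h1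
    have h2 := integral_mono (μ := alg.law) (integrable_const _)
      (integrable_finsetSum Finset.univ fun θ _ => hint θ) hsum
    have h3 : ∑ _θ : Fin d → Bool, (d * K / 8 : ℝ) = 2 ^ d * (d * (1 / 8 * (K * 2) / 2)) := by
      simp; ring
    simp only [integral_const, probReal_univ, one_smul] at h2
    linarith
  have hpref : ∀ π₁ π₂, policyPref (P θ) s₁ (T θ) π₁ π₂ = 1 / 2 +
      η * ∑ j, bitError s₁ hH π₂ j (θ j) - η * ∑ j, bitError s₁ hH π₁ j (θ j) := fun π₁ π₂ => by
    rw [policyPref_eq (hg θ), hval, hval]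
    ring
  have hbest : ∑ j, bitError s₁ hH (constPolicy θ) j (θ j) = 0 :=
    Finset.sum_eq_zero fun j _ => bitError_constPolicy s₁ hH θ j
  have hnn : ∀ π, 0 ≤ η * ∑ j, bitError s₁ hH π j (θ j) := fun π =>
    mul_nonneg hη (Finset.sum_nonneg fun j _ => bitError_nonneg _ _ _ _ _)
  refine ⟨θ, ⟨constPolicy θ, fun π => ?_⟩, fun πstar hopt => ?_⟩
  · rw [hpref, hbest]
    linarith [hnn π]
  -- Comparison with the error-free `constPolicy θ` leaves an optimal policy no loss, so the regret
  -- is the same for every choice of `πstar`.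
  · have h0 : η * ∑ j, bitError s₁ hH πstar j (θ j) = 0 := by
      have h1 := hopt (constPolicy θ)
      rw [hpref, hbest] at h1
      linarith [hnn πstar]
    have hreg : expectedRegret (P θ) s₁ (T θ) πstar alg =
        η * ∫ ω, expectedErrors s₁ hH alg ω (P θ) θ (T θ) ∂alg.law := by
      rw [← integral_const_mul]
      refine integral_congr_ae (Filter.Eventually.of_forall fun ω => ?_)
      simp only [expectedErrors]
      rw [Finset.mul_sum]
      refine Finset.sum_congr rfl fun D _ => ?_
      rw [mul_left_comm]
      congr 1
      simp only [totalBitError]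
      rw [Finset.sum_comm (s := Finset.univ (α := Fin d)), Finset.mul_sum]
      refine Finset.sum_congr rfl fun k _ => ?_
      rw [Finset.sum_comm (s := Finset.univ (α := Fin d)), Finset.mul_sum]
      refine Finset.sum_congr rfl fun i _ => ?_
      rw [hpref, h0]
      ring
    rw [hreg]
    exact mul_le_mul_of_nonneg_left hθ hη

end Assouad

/-! ### Affinity of a single episode -/

section Affinity

variable {S A : Type} [Fintype S] [Fintype A] {H : ℕ}

theorem sum_sqrt_mul_self {X : Type} [Fintype X] {p : X → ℝ} (hp : ∀ x, 0 ≤ p x)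
    (hp1 : ∑ x, p x = 1) : ∑ x, √(p x * p x) = 1 := by
  simp only [Real.sqrt_mul_self (hp _), hp1]

/-- The Bhattacharyya coefficient of the laws of the observations in one episode. -/
theorem mul_le_sum_sqrt_episodeProb {P P' : Transition S A} {s₁ : S}
    {T T' : Traj S A H → Traj S A H → ℝ}
    {π₁ π₂ : Policy S A H} {ρ σ : ℝ} (hρ : 0 ≤ ρ) (hσ : 0 ≤ σ)
    (h₁ : ρ ≤ ∑ τ, √(trajProb P s₁ π₁ τ * trajProb P' s₁ π₁ τ))
    (h₂ : ρ ≤ ∑ τ, √(trajProb P s₁ π₂ τ * trajProb P' s₁ π₂ τ))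
    (h : ∀ τ₁ τ₂, σ ≤ √(T τ₁ τ₂ * T' τ₁ τ₂) + √((1 - T τ₁ τ₂) * (1 - T' τ₁ τ₂))) :
    ρ * ρ * σ ≤ ∑ x, √(episodeProb P s₁ T π₁ π₂ x * episodeProb P' s₁ T' π₁ π₂ x) := by
  have e : ∀ τ₁ τ₂ (t t' : ℝ),
      √(trajProb P s₁ π₁ τ₁ * trajProb P s₁ π₂ τ₂ * t *
        (trajProb P' s₁ π₁ τ₁ * trajProb P' s₁ π₂ τ₂ * t')) =
      √(trajProb P s₁ π₁ τ₁ * trajProb P' s₁ π₁ τ₁) *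
        (√(trajProb P s₁ π₂ τ₂ * trajProb P' s₁ π₂ τ₂) * √(t * t')) := fun τ₁ τ₂ t t' => by
    rw [← Real.sqrt_mul (mul_nonneg (trajProb_nonneg _ _ _ _) (trajProb_nonneg _ _ _ _)),
      ← Real.sqrt_mul (mul_nonneg (trajProb_nonneg _ _ _ _) (trajProb_nonneg _ _ _ _))]
    congr 1
    ring
  simp only [episodeProb, Fintype.sum_prod_type, Fintype.sum_bool, if_true, Bool.false_eq_true,
    if_false, e, ← mul_add]
  calc ρ * ρ * σ ≤ (∑ τ, √(trajProb P s₁ π₁ τ * trajProb P' s₁ π₁ τ)) *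
        (∑ τ, √(trajProb P s₁ π₂ τ * trajProb P' s₁ π₂ τ)) * σ :=
      mul_le_mul_of_nonneg_right (mul_le_mul h₁ h₂ hρ (hρ.trans h₁)) hσ
    _ = ∑ τ₁, ∑ τ₂, √(trajProb P s₁ π₁ τ₁ * trajProb P' s₁ π₁ τ₁) *
        (√(trajProb P s₁ π₂ τ₂ * trajProb P' s₁ π₂ τ₂) * σ) := by
      simp only [← Finset.mul_sum, ← Finset.sum_mul, mul_assoc]
    _ ≤ _ := Finset.sum_le_sum fun τ₁ _ => Finset.sum_le_sum fun τ₂ _ => by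
      have := h τ₁ τ₂
      gcongr

/-- The Bhattacharyya coefficient of the laws of a trajectory when the transition kernels differ
only at the initial state, to which the process never returns. -/
theorem le_sum_sqrt_trajProb (hH : 2 ≤ H) {P P' : Transition S A} {s₁ : S}
    (hret : ∀ s a, (P s a : S → ℝ) s₁ = 0) (heq : ∀ s a, s ≠ s₁ → P s a = P' s a) {ρ : ℝ}
    (hρ : 0 ≤ ρ) (hρ1 : ρ ≤ 1) (haff : ∀ a, ρ ≤ ∑ s, √((P s₁ a : S → ℝ) s * (P' s₁ a : S → ℝ) s))
    (π : Policy S A H) : ρ ≤ ∑ τ, √(trajProb P s₁ π τ * trajProb P' s₁ π τ) := by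
  -- Only the law of the second state, at index `1`, separates the kernels. It alone is charged `ρ`,
  -- so the bound does not degrade with `H`.
  have hprod : ∏ k : Fin H, (if k = ⟨1, by omega⟩ then ρ else 1) = ρ := by simp
  refine hprod.symm.le.trans (prod_le_sum_sqrt_seqProb _ _ (stepProb_nonneg P s₁ π)
    (stepProb_nonneg P' s₁ π) _ (fun k => by split_ifs <;> simp [hρ]) fun k b hb => ?_)
  by_cases h0 : (k : ℕ) = 0
  · have h1 : k ≠ ⟨1, by omega⟩ := fun h => by simp [h] at h0
    have h2 : ∀ x, stepProb P' s₁ π k b x = stepProb P s₁ π k b x := fun x => by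
      simp [stepProb, h0]
    simp only [h2, sum_sqrt_mul_self (stepProb_nonneg P s₁ π k b) (sum_stepProb P s₁ π k b), h1,
      if_false, le_refl]
  · have h1 : ∑ x, √(stepProb P s₁ π k b x * stepProb P' s₁ π k b x) =
        ∑ s, √((P (b ⟨k - 1, by omega⟩).1 (b ⟨k - 1, by omega⟩).2 : S → ℝ) s *
          (P' (b ⟨k - 1, by omega⟩).1 (b ⟨k - 1, by omega⟩).2 : S → ℝ) s) := by
      rw [Fintype.sum_prod_type]
      refine Finset.sum_congr rfl fun s _ => ?_
      have h2 : ∀ a, √(stepProb P s₁ π k b (s, a) * stepProb P' s₁ π k b (s, a)) =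
          √((P (b ⟨k - 1, by omega⟩).1 (b ⟨k - 1, by omega⟩).2 : S → ℝ) s *
          (P' (b ⟨k - 1, by omega⟩).1 (b ⟨k - 1, by omega⟩).2 : S → ℝ) s) *
          (π k b s : A → ℝ) a := fun a => by
        simp only [stepProb, h0, dite_false]
        rw [mul_mul_mul_comm, Real.sqrt_mul
          (mul_nonneg (stdSimplex_apply_nonneg _ _) (stdSimplex_apply_nonneg _ _)),
          Real.sqrt_mul_self (stdSimplex_apply_nonneg _ _)]
      simp only [h2]
      rw [← Finset.mul_sum, sum_stdSimplex, mul_one]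
    rw [h1]
    by_cases hs : (b ⟨k - 1, by omega⟩).1 = s₁
    · have hk : k = ⟨1, by omega⟩ := by
        -- At any later step, a preceding state `s₁` would be a return, and the history would have
        -- probability zero against `hb`.
        by_contra hk
        have hk1 : (k : ℕ) ≠ 1 := fun h => hk (Fin.ext h)
        refine hb (Finset.prod_eq_zero (Finset.mem_univ (⟨k - 1, by omega⟩ : Fin k)) ?_)
        have h3 : (k : ℕ) - 1 ≠ 0 := by omega
        simp [stepProb, h3, hs, hret]
      rw [if_pos hk, hs]
      exact haff _
    · rw [← heq _ _ hs, sum_sqrt_mul_self (stdSimplex_apply_nonneg _) (sum_stdSimplex _)]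
      split_ifs
      · exact hρ1
      · exact le_rfl

end Affinity

/-! ### Sign vectors and vectors with a distinguished coordinate -/

section Signs

variable {d : ℕ}

/-- The sign `±1` of a bit. -/
def boolSign (b : Bool) : ℝ := if b then 1 else -1

theorem boolSign_mul (a b : Bool) :
    boolSign b * boolSign a = 1 - 2 * if a = b then 0 else 1 := by
  cases a <;> cases b <;> norm_num [boolSign]

theorem boolSign_sq (b : Bool) : boolSign b ^ 2 = 1 := by
  cases b <;> norm_num [boolSign]

theorem boolSign_not (b : Bool) : boolSign (!b) = -boolSign b := by
  cases b <;> norm_num [boolSign]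

/-- The inner product of two sign vectors. -/
def signInner (θ a : Fin d → Bool) : ℝ := ∑ j, boolSign (θ j) * boolSign (a j)

theorem abs_signInner_le (θ a : Fin d → Bool) : |signInner θ a| ≤ d := by
  calc |signInner θ a| ≤ ∑ j, |boolSign (θ j) * boolSign (a j)| := Finset.abs_sum_le_sum_abs _ _
    _ ≤ ∑ _j : Fin d, (1 : ℝ) := Finset.sum_le_sum fun j _ => by
      cases θ j <;> cases a j <;> norm_num [boolSign]
    _ = d := by simp

theorem signInner_flipBit (j : Fin d) (θ a : Fin d → Bool) :
    signInner (flipBit j θ) a = signInner θ a - 2 * (boolSign (θ j) * boolSign (a j)) := by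
  have h : ∀ i, boolSign (flipBit j θ i) * boolSign (a i) = boolSign (θ i) * boolSign (a i) -
      if i = j then 2 * (boolSign (θ j) * boolSign (a j)) else 0 := fun i => by
    by_cases h : i = j
    · subst h
      rw [flipBit_self, boolSign_not, if_pos rfl]
      ring
    · rw [flipBit_of_ne h, if_neg h, sub_zero]
  simp only [signInner, h, Finset.sum_sub_distrib, Finset.sum_ite_eq', Finset.mem_univ, if_true]

/-- Each wrong bit lowers the inner product by `2`, whence the factor `2` in the choices of `η`
below. -/
theorem sum_firstAction_mul_signInner {S : Type} {H : ℕ} (s₁ : S) (hH : 0 < H)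
    (π : Policy S (Fin d → Bool) H) (θ : Fin d → Bool) :
    ∑ a, firstAction s₁ hH π a * signInner θ a =
      d - 2 * ∑ j, bitError s₁ hH π j (θ j) := by
  have h : ∀ a, firstAction s₁ hH π a * signInner θ a = firstAction s₁ hH π a * d -
      ∑ j, 2 * (firstAction s₁ hH π a * if a j = θ j then 0 else 1) := fun a => by
    simp only [signInner, boolSign_mul, Finset.sum_sub_distrib, ← Finset.mul_sum]
    simp
    ring
  simp only [h, Finset.sum_sub_distrib, ← Finset.sum_mul, sum_firstAction, one_mul]
  rw [Finset.sum_comm]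
  simp only [bitError, Finset.mul_sum]

/-- The vector with first coordinate `x` and further coordinates `y`. -/
def consVec (x : ℝ) (y : Fin d → ℝ) : EuclideanSpace ℝ (Fin (d + 1)) :=
  WithLp.toLp 2 (Fin.cons x y)

theorem inner_consVec (x x' : ℝ) (y y' : Fin d → ℝ) :
    inner ℝ (consVec x y) (consVec x' y') = x * x' + ∑ j, y j * y' j := by
  simp [consVec, PiLp.inner_apply, Fin.sum_univ_succ, mul_comm]

theorem norm_consVec_le {x : ℝ} {y : Fin d → ℝ} {r : ℝ} (hr : 0 ≤ r)
    (h : x ^ 2 + ∑ j, y j ^ 2 ≤ r ^ 2) : ‖consVec x y‖ ≤ r := by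
  refine le_of_sq_le_sq ?_ hr
  rw [← real_inner_self_eq_norm_sq, inner_consVec]
  simpa only [← sq] using h

theorem sum_mul_boolSign_sq {c : ℝ} (a : Fin d → Bool) :
    ∑ j, (c * boolSign (a j)) ^ 2 = d * c ^ 2 := by
  simp [mul_pow, boolSign_sq]

end Signs

/-! ### Hard preferences -/

section Preference

variable {d m H : ℕ} {L B R : ℝ}

theorem transition_unit_eq {A : Type} (P P' : Transition Unit A) : P = P' := by
  funext s a
  refine Subtype.ext (funext fun s' => ?_)
  have h1 := (P s a).2.2
  have h2 := (P' s a).2.2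
  rw [Fintype.sum_unique] at h1 h2
  exact h1.trans h2.symm

/-- The features of a one-state instance whose preferences compare the first actions. -/
def prefFeatures (hH : 0 < H) (m : ℕ) (hd : 0 < d) (hL : 0 ≤ L) (α γ : ℝ)
    (h : α ^ 2 + 4 * γ ^ 2 ≤ L ^ 2) :
    LinearFeatures Unit (Fin d → Bool) H (m + 1) (d + 1) L where
  φ _ _ _ := consVec 1 0
  norm_φ _ _ V hV := by
    have h1 : ‖consVec 1 (0 : Fin m → ℝ)‖ ≤ 1 := norm_consVec_le zero_le_one (by simp)
    have h2 := hV ()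
    rw [Fintype.sum_unique, norm_smul, Real.norm_of_nonneg h2.1]
    exact mul_le_one₀ h2.2 (norm_nonneg _) h1
  ψ τ₁ τ₂ := consVec α fun j =>
    γ / √d * (boolSign ((τ₁ ⟨0, hH⟩).2 j) - boolSign ((τ₂ ⟨0, hH⟩).2 j))
  norm_ψ τ₁ τ₂ := by
    refine norm_consVec_le hL (le_trans ?_ h)
    have h1 : ∀ j, (γ / √d * (boolSign ((τ₁ ⟨0, hH⟩).2 j) - boolSign ((τ₂ ⟨0, hH⟩).2 j))) ^ 2 ≤
        γ ^ 2 / d * 4 := fun j => by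
      rw [mul_pow, div_pow, Real.sq_sqrt (Nat.cast_nonneg d)]
      refine mul_le_mul_of_nonneg_left ?_ (by positivity)
      cases (τ₁ ⟨0, hH⟩).2 j <;> cases (τ₂ ⟨0, hH⟩).2 j <;> norm_num [boolSign]
    have h2 := Finset.sum_le_sum fun j (_ : j ∈ Finset.univ) => h1 j
    have hd' : (d : ℝ) ≠ 0 := by positivity
    have h3 : ∑ _j : Fin d, γ ^ 2 / d * 4 = 4 * γ ^ 2 := by
      simp
      field_simp
    linarith

/-- The scales `γ / √d` and `Δ * √d / γ` are balanced: the feature norm is bounded independently of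
`d`, while the sign part of the parameter has norm `Δ * d / γ`. -/
theorem inner_prefFeatures {hH : 0 < H} {hd : 0 < d} {hL : 0 ≤ L} {α γ : ℝ} (hα : α ≠ 0)
    (hγ : γ ≠ 0) {h : α ^ 2 + 4 * γ ^ 2 ≤ L ^ 2} (Δ : ℝ) (θ : Fin d → Bool)
    (τ₁ τ₂ : Traj Unit (Fin d → Bool) H) :
    inner ℝ ((prefFeatures hH m hd hL α γ h).ψ τ₁ τ₂)
      (consVec (1 / (2 * α)) fun j => Δ * √d / γ * boolSign (θ j)) =
      1 / 2 + Δ * signInner θ (τ₁ ⟨0, hH⟩).2 - Δ * signInner θ (τ₂ ⟨0, hH⟩).2 := by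
  have hs : √(d : ℝ) ≠ 0 := by positivity
  simp only [prefFeatures, inner_consVec, signInner, Finset.mul_sum]
  rw [add_sub_assoc, ← Finset.sum_sub_distrib]
  congr 1
  · field_simp
  · refine Finset.sum_congr rfl fun j _ => ?_
    field_simp

/-- The instance with preferences `1 / 2 + Δ * (⟨θ, a₁⟩ - ⟨θ, a₂⟩)`. -/
def prefInstance (hH : 0 < H) (m : ℕ) (hd : 0 < d) (hL : 0 ≤ L) (hB : 1 ≤ B) (hR : 0 ≤ R)
    {α γ : ℝ} (hα : α ≠ 0) (hγ : γ ≠ 0) (h : α ^ 2 + 4 * γ ^ 2 ≤ L ^ 2) {Δ : ℝ} (hΔ : 0 ≤ Δ)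
    (hΔd : Δ * d ≤ 1 / 8) (hΔR : (1 / (2 * α)) ^ 2 + (Δ * d / γ) ^ 2 ≤ R ^ 2)
    (θ : Fin d → Bool) : LinearInstance (prefFeatures hH m hd hL α γ h) B R where
  θP := consVec 1 0
  norm_θP := (norm_consVec_le zero_le_one (by simp)).trans hB
  isTransition s a := by
    simp only [prefFeatures, inner_consVec]
    refine ⟨fun _ => by simp, by simp⟩
  θT := consVec (1 / (2 * α)) fun j => Δ * √d / γ * boolSign (θ j)
  norm_θT := by
    refine norm_consVec_le hR (le_trans (le_of_eq ?_) hΔR)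
    rw [sum_mul_boolSign_sq, div_pow (Δ * √d), mul_pow Δ (√d), Real.sq_sqrt (Nat.cast_nonneg d)]
    ring
  isPreference τ₁ τ₂ := by
    simp only [inner_prefFeatures hα hγ]
    have h1 := abs_le.1 (abs_signInner_le θ (τ₁ ⟨0, hH⟩).2)
    have h2 := abs_le.1 (abs_signInner_le θ (τ₂ ⟨0, hH⟩).2)
    have h3 := mul_le_mul_of_nonneg_left h1.1 hΔ
    have h4 := mul_le_mul_of_nonneg_left h1.2 hΔ
    have h5 := mul_le_mul_of_nonneg_left h2.1 hΔ
    have h6 := mul_le_mul_of_nonneg_left h2.2 hΔ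
    exact ⟨⟨by linarith, by linarith⟩, by ring⟩

/-- Features for which every `Δ` of order at most `1 / d` gives instances with preferences
`1 / 2 + Δ * (⟨θ, a₁⟩ - ⟨θ, a₂⟩)`. -/
theorem exists_prefInstances (hB : 1 < B) (hL : 0 < L) (hR : 0 < R) (hLR : 1 / 2 < L * R) :
    ∃ κ : ℝ, 0 < κ ∧ κ ≤ 1 / 8 ∧ ∀ (H d m : ℕ) (hH : 0 < H), 0 < d →
      ∃ F : LinearFeatures Unit (Fin d → Bool) H (m + 1) (d + 1) L, ∀ Δ : ℝ, 0 ≤ Δ → Δ * d ≤ κ →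
        ∃ M : (Fin d → Bool) → LinearInstance F B R, ∀ θ τ₁ τ₂, (M θ).pref τ₁ τ₂ =
          1 / 2 + Δ * signInner θ (τ₁ ⟨0, hH⟩).2 - Δ * signInner θ (τ₂ ⟨0, hH⟩).2 := by
  -- The coordinates `α` and `1 / (2 * α)` produce the constant `1 / 2`. The strict inequality `1 /
  -- 2 < L * R` lets both stay strictly below `L` and `R`; `γ` and `ρ` measure what remains of the
  -- two norm budgets for the signs.
  obtain ⟨α, hα1, hα2⟩ : ∃ α, 1 / (2 * R) < α ∧ α < L :=
    exists_between (by rw [div_lt_iff₀ (by positivity)]; linarith)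
  have hα : 0 < α := lt_trans (by positivity) hα1
  have hLα : 0 < L ^ 2 - α ^ 2 := by nlinarith
  have hRα : 0 < R ^ 2 - (1 / (2 * α)) ^ 2 := by
    have h1 : 1 / (2 * α) < R := by
      rw [div_lt_iff₀ (by positivity)] at hα1 ⊢
      linarith
    have h2 : 0 < 1 / (2 * α) := by positivity
    nlinarith
  set γ := √(L ^ 2 - α ^ 2) / 2 with hγdef
  have hγ : 0 < γ := half_pos (Real.sqrt_pos.2 hLα)
  have hγ2 : α ^ 2 + 4 * γ ^ 2 ≤ L ^ 2 := by
    rw [hγdef, div_pow, Real.sq_sqrt hLα.le]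
    linarith
  set ρ := √(R ^ 2 - (1 / (2 * α)) ^ 2) with hρdef
  have hρ : 0 < ρ := Real.sqrt_pos.2 hRα
  -- `γ * ρ` makes the sign part of the parameter fit into `ρ`; `1 / 8` keeps the preferences within
  -- `[1/4, 3/4]`.
  set κ := min (γ * ρ) (1 / 8)
  have hκ : 0 < κ := lt_min (mul_pos hγ hρ) (by norm_num)
  refine ⟨κ, hκ, min_le_right _ _, fun H d m hH0 hd => ?_⟩
  refine ⟨prefFeatures hH0 m hd hL.le α γ hγ2, fun Δ hΔ hΔκ => ?_⟩
  have hΔd : Δ * d ≤ 1 / 8 := hΔκ.trans (min_le_right _ _)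
  have hΔR : (1 / (2 * α)) ^ 2 + (Δ * d / γ) ^ 2 ≤ R ^ 2 := by
    have h1 : Δ * d / γ ≤ ρ := by
      rw [div_le_iff₀ hγ, mul_comm ρ]
      exact hΔκ.trans (min_le_left _ _)
    have h2 : (Δ * d / γ) ^ 2 ≤ ρ ^ 2 := pow_le_pow_left₀ (by positivity) h1 2
    rw [hρdef, Real.sq_sqrt hRα.le] at h2
    linarith
  exact ⟨prefInstance hH0 m hd hL.le hB.le hR.le hα.ne' hγ.ne' hγ2 hΔ hΔd hΔR,
    fun θ τ₁ τ₂ => inner_prefFeatures hα.ne' hγ.ne' Δ θ τ₁ τ₂⟩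

/-- The lower bound that is due to the unknown preferences. -/
theorem exists_prefFeatures (hB : 1 < B) (hL : 0 < L) (hR : 0 < R) (hLR : 1 / 2 < L * R) :
    ∃ c : ℝ, 0 < c ∧ ∀ H d m : ℕ, 2 ≤ H → 0 < d →
      ∃ F : LinearFeatures Unit (Fin d → Bool) H (m + 1) (d + 1) L,
        ∀ K : ℕ, d ^ 2 ≤ K → ∀ alg : Algorithm.{u} Unit (Fin d → Bool) H K,
          ∃ M : LinearInstance F B R,
            (∃ πstar, IsOptimal M.transition () M.pref πstar) ∧
            ∀ πstar, IsOptimal M.transition () M.pref πstar →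
              c * (d * √(K : ℝ)) ≤ expectedRegret M.transition () M.pref πstar alg := by
  obtain ⟨κ, hκ, hκ8, hF⟩ := exists_prefInstances hB hL hR hLR
  refine ⟨κ / 4, by positivity, fun H d m hH hd => ?_⟩
  have hH0 : 0 < H := by omega
  obtain ⟨F, hM⟩ := hF H d m hH0 hd
  refine ⟨F, fun K hK alg => ?_⟩
  have hd' : (1 : ℝ) ≤ d := by exact_mod_cast hd
  have hdK : (d : ℝ) ≤ √(K : ℝ) := Real.le_sqrt_of_sq_le (by exact_mod_cast hK)
  have hK0 : 0 < √(K : ℝ) := by linarith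
  have hKK : √(K : ℝ) ^ 2 = K := Real.sq_sqrt (Nat.cast_nonneg K)
  -- The largest order of signal that `K` episodes cannot detect; `d ≤ √K` gives `Δ * d ≤ κ`.
  set Δ := κ / √(K : ℝ) with hΔdef
  have hΔ : 0 < Δ := by positivity
  have hΔK : Δ * √(K : ℝ) = κ := by rw [hΔdef]; field_simp
  have hΔκ : Δ * d ≤ κ := hΔK ▸ mul_le_mul_of_nonneg_left hdK hΔ.le
  have hΔd : Δ * d ≤ 1 / 8 := hΔκ.trans hκ8
  have hΔ8 : Δ ≤ 1 / 8 := (le_mul_of_one_le_right hΔ.le hd').trans hΔd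
  obtain ⟨M, hpref⟩ := hM Δ hΔ.le hΔκ
  have hmem : ∀ θ τ₁ τ₂, (M θ).pref τ₁ τ₂ ∈ Set.Icc (1 / 4 : ℝ) (3 / 4) := fun θ τ₁ τ₂ => by
    rw [hpref]
    have h1 := abs_le.1 (abs_signInner_le θ (τ₁ ⟨0, hH0⟩).2)
    have h2 := abs_le.1 (abs_signInner_le θ (τ₂ ⟨0, hH0⟩).2)
    have h3 := mul_le_mul_of_nonneg_left h1.1 hΔ.le
    have h4 := mul_le_mul_of_nonneg_left h1.2 hΔ.le
    have h5 := mul_le_mul_of_nonneg_left h2.1 hΔ.le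
    have h6 := mul_le_mul_of_nonneg_left h2.2 hΔ.le
    exact ⟨by linarith, by linarith⟩
  -- Flipping a bit shifts a preference by at most `4 * Δ`, hence `ε = 16 * Δ ^ 2`; then `K * ε = 16
  -- * κ ^ 2 ≤ 1 / 4`.
  have hmain := exists_le_expectedRegret (C := Δ * d) (η := 2 * Δ) (ε := 16 * Δ ^ 2)
    hH0 () (fun θ => (M θ).transition) (fun θ => (M θ).pref)
    (fun θ τ => Δ * signInner θ (τ ⟨0, hH0⟩).2) (fun θ => (M θ).isPreference) hpref
    (by positivity) (fun θ π => ?_) (fun θ j π₁ π₂ => ?_) (by nlinarith) ?_ alg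
  · obtain ⟨θ, h1, h2⟩ := hmain
    refine ⟨M θ, h1, fun πstar hopt => le_trans (le_of_eq ?_) (h2 πstar hopt)⟩
    rw [← hΔK]
    linear_combination (Δ * d / 4) * hKK
  · have h := sum_trajProb_mul (M θ).transition () hH π fun x _ => Δ * signInner θ x.2
    refine h.trans ?_
    simp only [← Finset.sum_mul, sum_stdSimplex, one_mul, mul_left_comm _ Δ, ← Finset.mul_sum,
      sum_firstAction_mul_signInner]
    ring
  · rw [transition_unit_eq (M (flipBit j θ)).transition (M θ).transition]
    have h := mul_le_sum_sqrt_episodeProb (P := (M θ).transition)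
      (P' := (M θ).transition) (s₁ := ()) (T := (M θ).pref)
      (T' := (M (flipBit j θ)).pref) (π₁ := π₁) (π₂ := π₂) (ρ := 1) (σ := 1 - 16 * Δ ^ 2)
      zero_le_one (by nlinarith)
      (sum_sqrt_mul_self (trajProb_nonneg _ _ π₁) (sum_trajProb _ _ π₁)).ge
      (sum_sqrt_mul_self (trajProb_nonneg _ _ π₂) (sum_trajProb _ _ π₂)).ge
      fun τ₁ τ₂ => ?_
    · simpa only [one_mul] using h
    · refine le_trans ?_ (one_sub_sq_le_sqrt_add_sqrt (hmem _ _ _) (hmem _ _ _))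
      have h3 : ((M θ).pref τ₁ τ₂ - (M (flipBit j θ)).pref τ₁ τ₂) ^ 2 = 4 * Δ ^ 2 *
          (boolSign (θ j) ^ 2 * (boolSign ((τ₁ ⟨0, hH0⟩).2 j) -
            boolSign ((τ₂ ⟨0, hH0⟩).2 j)) ^ 2) := by
        rw [hpref, hpref, signInner_flipBit, signInner_flipBit]
        ring
      have h4 : (boolSign ((τ₁ ⟨0, hH0⟩).2 j) - boolSign ((τ₂ ⟨0, hH0⟩).2 j)) ^ 2 ≤ 4 := by
        cases (τ₁ ⟨0, hH0⟩).2 j <;> cases (τ₂ ⟨0, hH0⟩).2 j <;> norm_num [boolSign]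
      rw [h3, boolSign_sq, one_mul]
      nlinarith [sq_nonneg Δ]
  · have h5 : K * (16 * Δ ^ 2) = 16 * κ ^ 2 := by
      rw [← hKK, ← hΔK]
      ring
    rw [h5]
    nlinarith

end Preference

/-! ### Hard transitions -/

section Transition

variable {d m H : ℕ} {L B R : ℝ}

/-- The feature map of a three-state transition model: from the state `none` the process moves to
`some true` or `some false`, where it stays. -/
def transFeature (α γ : ℝ) :
    Option Bool → (Fin d → Bool) → Option Bool → EuclideanSpace ℝ (Fin (d + 1))
  | none, a, some b => consVec (α / 2) fun j => boolSign b * (γ / √d) * boolSign (a j)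
  | some b, _, some b' => if b' = b then consVec α 0 else 0
  | _, _, none => 0

/-- The utility of a trajectory: whether its second state is `some true`. -/
def reachesGood (hH : 1 < H) (τ : Traj (Option Bool) (Fin d → Bool) H) : ℝ :=
  if (τ ⟨1, hH⟩).1 = some true then 1 else 0

theorem smul_consVec (c x : ℝ) (y : Fin d → ℝ) :
    c • consVec x y = consVec (c * x) fun j => c * y j := by
  ext i
  refine Fin.cases ?_ (fun j => ?_) i <;> simp [consVec]

theorem consVec_add (x x' : ℝ) (y y' : Fin d → ℝ) :
    consVec x y + consVec x' y' = consVec (x + x') fun j => y j + y' j := by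
  ext i
  refine Fin.cases ?_ (fun j => ?_) i <;> simp [consVec]

/-- From `none`, the first coordinate is `α` times the mean of two values in `[0, 1]`, and the
others are `± γ / √d` times their difference. Both factors are at most `1` in absolute value, so the
squared norm is at most `α ^ 2 + γ ^ 2`. -/
theorem norm_sum_smul_transFeature_le (hd : 0 < d) {α γ : ℝ} (h : α ^ 2 + γ ^ 2 ≤ 1)
    (s : Option Bool) (a : Fin d → Bool) {V : Option Bool → ℝ}
    (hV : ∀ s', V s' ∈ Set.Icc (0 : ℝ) 1) :
    ‖∑ s', V s' • transFeature α γ s a s'‖ ≤ 1 := by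
  have ht := hV (some true)
  have hf := hV (some false)
  rw [Fintype.sum_option, Fintype.sum_bool]
  rcases s with _ | b
  · simp only [transFeature, smul_zero, zero_add, smul_consVec, consVec_add]
    refine norm_consVec_le zero_le_one ?_
    have h1 : ∀ j, V (some true) * (boolSign true * (γ / √d) * boolSign (a j)) +
        V (some false) * (boolSign false * (γ / √d) * boolSign (a j)) =
        (V (some true) - V (some false)) * (γ / √d) * boolSign (a j) := fun j => by
      simp only [boolSign, if_true, Bool.false_eq_true, if_false]
      ring
    have hd' : (d : ℝ) ≠ 0 := by positivity
    simp only [h1]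
    rw [sum_mul_boolSign_sq, mul_pow, div_pow, Real.sq_sqrt (Nat.cast_nonneg d)]
    have h2 : (d : ℝ) * ((V (some true) - V (some false)) ^ 2 * (γ ^ 2 / d)) =
        (V (some true) - V (some false)) ^ 2 * γ ^ 2 := by field_simp
    have h3 : (V (some true) - V (some false)) ^ 2 ≤ 1 := by nlinarith [ht.1, ht.2, hf.1, hf.2]
    have h4 : ((V (some true) + V (some false)) / 2) ^ 2 ≤ 1 := by
      nlinarith [ht.1, ht.2, hf.1, hf.2]
    have h5 := mul_le_mul_of_nonneg_right h3 (sq_nonneg γ)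
    have h6 := mul_le_mul_of_nonneg_right h4 (sq_nonneg α)
    rw [h2]
    nlinarith
  · have hα : ‖consVec α (0 : Fin d → ℝ)‖ ≤ 1 :=
      norm_consVec_le zero_le_one <| by
        have h1 : ∑ j : Fin d, (0 : Fin d → ℝ) j ^ 2 = 0 := by simp
        linarith [sq_nonneg γ]
    have h1 : ∀ v ∈ Set.Icc (0 : ℝ) 1, ‖v • consVec α (0 : Fin d → ℝ)‖ ≤ 1 := fun v hv => by
      rw [norm_smul, Real.norm_of_nonneg hv.1]
      exact mul_le_one₀ hv.2 (norm_nonneg _) hα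
    cases b
    · simpa [transFeature] using h1 _ hf
    · simpa [transFeature] using h1 _ ht

/-- The features of a three-state instance whose first transition is unknown. -/
def transFeatures (hH : 1 < H) (m : ℕ) (hd : 0 < d) (hL : 0 ≤ L) (hR : 0 < R) (α γ : ℝ)
    (h : α ^ 2 + γ ^ 2 ≤ 1) {δ : ℝ} (hδ : 0 ≤ δ) (hδ2 : δ ≤ 1 / 2) (hδL : 1 / 2 + δ ≤ L * R) :
    LinearFeatures (Option Bool) (Fin d → Bool) H (d + 1) (m + 1) L where
  φ := transFeature α γ
  norm_φ s a _ hV := norm_sum_smul_transFeature_le hd h s a hV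
  -- The preference is fully known: it is encoded in the first coordinate, scaled for the parameter
  -- `R`, and the other `m` coordinates are padding.
  ψ τ₁ τ₂ := consVec ((1 / 2 + δ * reachesGood hH τ₁ - δ * reachesGood hH τ₂) / R) 0
  norm_ψ τ₁ τ₂ := by
    refine norm_consVec_le hL ?_
    have h1 : ∀ x, 0 ≤ x → x ≤ L * R → (x / R) ^ 2 ≤ L ^ 2 := fun x hx hxL =>
      pow_le_pow_left₀ (by positivity) ((div_le_iff₀ hR).2 hxL) 2
    simp only [Pi.zero_apply, ne_eq, OfNat.ofNat_ne_zero, not_false_eq_true, zero_pow,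
      Finset.sum_const_zero, add_zero]
    refine h1 _ ?_ ?_ <;> unfold reachesGood <;> split_ifs <;> linarith

theorem inner_transFeature_none (hd : 0 < d) {α γ : ℝ} (hα : α ≠ 0) (hγ : γ ≠ 0) (Δ : ℝ)
    (θ a : Fin d → Bool) (b : Bool) :
    inner ℝ (transFeature α γ none a (some b))
      (consVec (1 / α) fun j => Δ * √d / γ * boolSign (θ j)) =
      1 / 2 + boolSign b * (Δ * signInner θ a) := by
  have hs : √(d : ℝ) ≠ 0 := by positivity
  simp only [transFeature, inner_consVec, signInner, Finset.mul_sum]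
  congr 1
  · field_simp
  · refine Finset.sum_congr rfl fun j _ => ?_
    field_simp

theorem inner_transFeature_some {α : ℝ} (hα : α ≠ 0) (γ : ℝ) (y : Fin d → ℝ) (a : Fin d → Bool)
    (b b' : Bool) :
    inner ℝ (transFeature α γ (some b) a (some b')) (consVec (1 / α) y) =
      if b' = b then 1 else 0 := by
  simp only [transFeature]
  split_ifs
  · simp [inner_consVec, hα]
  · simp

theorem transFeature_to_none (α γ : ℝ) (s : Option Bool) (a : Fin d → Bool) :
    transFeature α γ s a none = 0 := by
  cases s <;> rfl

/-- The instance in which `none` moves to `some true` with probability `1 / 2 + Δ * ⟨θ, a⟩`. -/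
def transInstance (hH : 1 < H) (m : ℕ) (hd : 0 < d) (hL : 0 ≤ L) (hB : 0 ≤ B) (hR : 0 < R)
    {α γ : ℝ} (hα : α ≠ 0) (hγ : γ ≠ 0) (h : α ^ 2 + γ ^ 2 ≤ 1) {δ : ℝ} (hδ : 0 ≤ δ)
    (hδ2 : δ ≤ 1 / 2) (hδL : 1 / 2 + δ ≤ L * R) {Δ : ℝ} (hΔ : 0 ≤ Δ)
    (hΔd : Δ * d ≤ 1 / 8) (hΔB : (1 / α) ^ 2 + (Δ * d / γ) ^ 2 ≤ B ^ 2)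
    (θ : Fin d → Bool) : LinearInstance (transFeatures hH m hd hL hR α γ h hδ hδ2 hδL) B R where
  θP := consVec (1 / α) fun j => Δ * √d / γ * boolSign (θ j)
  norm_θP := by
    refine norm_consVec_le hB (le_trans (le_of_eq ?_) hΔB)
    rw [sum_mul_boolSign_sq, div_pow (Δ * √d), mul_pow Δ (√d), Real.sq_sqrt (Nat.cast_nonneg d)]
    ring
  isTransition s a := by
    simp only [transFeatures]
    have h1 := abs_le.1 (abs_signInner_le θ a)
    have h3 := mul_le_mul_of_nonneg_left h1.1 hΔ
    have h4 := mul_le_mul_of_nonneg_left h1.2 hΔ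
    refine ⟨fun s' => ?_, ?_⟩
    · beta_reduce
      rcases s' with _ | b'
      · rw [transFeature_to_none, inner_zero_left]
      rcases s with _ | b
      · rw [inner_transFeature_none hd hα hγ]
        cases b' <;> simp only [boolSign] <;> norm_num <;> linarith
      · rw [inner_transFeature_some hα]
        split_ifs <;> norm_num
    · rw [Fintype.sum_option, Fintype.sum_bool, transFeature_to_none, inner_zero_left]
      rcases s with _ | b
      · rw [inner_transFeature_none hd hα hγ, inner_transFeature_none hd hα hγ]
        simp only [boolSign, if_true, Bool.false_eq_true, if_false]
        ring
      · rw [inner_transFeature_some hα, inner_transFeature_some hα]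
        cases b <;> norm_num
  θT := consVec R 0
  norm_θT := norm_consVec_le hR.le (by simp)
  isPreference τ₁ τ₂ := by
    have h1 : ∀ x : ℝ, x / R * R = x := fun x => div_mul_cancel₀ x hR.ne'
    simp only [transFeatures, inner_consVec, h1, Pi.zero_apply, mul_zero, Finset.sum_const_zero,
      add_zero]
    refine ⟨⟨?_, ?_⟩, by ring⟩ <;> unfold reachesGood <;> split_ifs <;> linarith

/-- Features for which every `Δ` of order at most `1 / d` gives instances in which `none` moves to
`some true` with probability `1 / 2 + Δ * ⟨θ, a⟩`. -/
theorem exists_transInstances (hB : 1 < B) (hL : 0 < L) (hR : 0 < R) (hLR : 1 / 2 < L * R) :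
    ∃ κ δ : ℝ, 0 < κ ∧ κ ≤ 1 / 8 ∧ 0 < δ ∧ ∀ (H d m : ℕ) (hH : 1 < H), 0 < d →
      ∃ F : LinearFeatures (Option Bool) (Fin d → Bool) H (d + 1) (m + 1) L,
        ∀ Δ : ℝ, 0 ≤ Δ → Δ * d ≤ κ → ∃ M : (Fin d → Bool) → LinearInstance F B R,
          (∀ θ τ₁ τ₂, (M θ).pref τ₁ τ₂ =
            1 / 2 + δ * reachesGood hH τ₁ - δ * reachesGood hH τ₂) ∧
          (∀ θ s a, ((M θ).transition s a : Option Bool → ℝ) none = 0) ∧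
          (∀ θ a b, ((M θ).transition none a : Option Bool → ℝ) (some b) =
            1 / 2 + boolSign b * (Δ * signInner θ a)) ∧
          ∀ θ a b b', ((M θ).transition (some b) a : Option Bool → ℝ) (some b') =
            if b' = b then 1 else 0 := by
  -- Here `1 < B` is the source of slack: `α < 1` and `1 / α < B` leave room for the signs in the
  -- feature and in the parameter.
  obtain ⟨α, hα1, hα2⟩ : ∃ α, 1 / B < α ∧ α < 1 :=
    exists_between (by rw [div_lt_iff₀ (by positivity)]; linarith)
  have hα : 0 < α := lt_trans (by positivity) hα1
  have hα3 : 0 < 1 - α ^ 2 := by nlinarith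
  have hBα : 0 < B ^ 2 - (1 / α) ^ 2 := by
    have h1 : 1 / α < B := by
      rw [div_lt_iff₀ (by positivity)] at hα1 ⊢
      linarith
    have h2 : 0 < 1 / α := by positivity
    nlinarith
  set γ := √(1 - α ^ 2) with hγdef
  have hγ : 0 < γ := Real.sqrt_pos.2 hα3
  have hγ2 : α ^ 2 + γ ^ 2 ≤ 1 := by
    rw [hγdef, Real.sq_sqrt hα3.le]
    linarith
  set ρ := √(B ^ 2 - (1 / α) ^ 2) with hρdef
  have hρ : 0 < ρ := Real.sqrt_pos.2 hBα
  set κ := min (γ * ρ) (1 / 8)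
  have hκ : 0 < κ := lt_min (mul_pos hγ hρ) (by norm_num)
  -- The excess of `L * R` over `1 / 2` pays for a positive utility `δ` of the good state.
  obtain ⟨δ, hδ, hδ2, hδL⟩ : ∃ δ : ℝ, 0 < δ ∧ δ ≤ 1 / 2 ∧ 1 / 2 + δ ≤ L * R :=
    ⟨min (1 / 2) (L * R - 1 / 2), lt_min (by norm_num) (by linarith), min_le_left _ _, by
      linarith [min_le_right (1 / 2) (L * R - 1 / 2)]⟩
  refine ⟨κ, δ, hκ, min_le_right _ _, hδ, fun H d m hH hd => ?_⟩
  refine ⟨transFeatures hH m hd hL.le hR α γ hγ2 hδ.le hδ2 hδL, fun Δ hΔ hΔκ => ?_⟩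
  have hΔd : Δ * d ≤ 1 / 8 := hΔκ.trans (min_le_right _ _)
  have hΔB : (1 / α) ^ 2 + (Δ * d / γ) ^ 2 ≤ B ^ 2 := by
    have h1 : Δ * d / γ ≤ ρ := by
      rw [div_le_iff₀ hγ, mul_comm ρ]
      exact hΔκ.trans (min_le_left _ _)
    have h2 : (Δ * d / γ) ^ 2 ≤ ρ ^ 2 := pow_le_pow_left₀ (by positivity) h1 2
    rw [hρdef, Real.sq_sqrt hBα.le] at h2
    linarith
  refine ⟨transInstance hH m hd hL.le (by linarith) hR hα.ne' hγ.ne' hγ2 hδ.le hδ2 hδL hΔ hΔd hΔB,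
    fun θ τ₁ τ₂ => ?_, fun θ s a => ?_,
    fun θ a b => inner_transFeature_none hd hα.ne' hγ.ne' Δ θ a b,
    fun θ a b b' => inner_transFeature_some hα.ne' γ _ a b b'⟩
  · refine (inner_consVec _ _ _ _).trans ?_
    rw [div_mul_cancel₀ _ hR.ne']
    simp
  · refine Eq.trans ?_ (inner_zero_left (𝕜 := ℝ)
      (consVec (1 / α) fun j => Δ * √d / γ * boolSign (θ j)))
    rw [← transFeature_to_none α γ s a]
    rfl

/-- The lower bound that is due to the unknown transitions. -/
theorem exists_transFeatures (hB : 1 < B) (hL : 0 < L) (hR : 0 < R) (hLR : 1 / 2 < L * R) :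
    ∃ c : ℝ, 0 < c ∧ ∀ H d m : ℕ, 2 ≤ H → 0 < d →
      ∃ F : LinearFeatures (Option Bool) (Fin d → Bool) H (d + 1) (m + 1) L,
        ∀ K : ℕ, d ^ 2 ≤ K → ∀ alg : Algorithm.{u} (Option Bool) (Fin d → Bool) H K,
          ∃ M : LinearInstance F B R,
            (∃ πstar, IsOptimal M.transition none M.pref πstar) ∧
            ∀ πstar, IsOptimal M.transition none M.pref πstar →
              c * (d * √(K : ℝ)) ≤ expectedRegret M.transition none M.pref πstar alg := by
  obtain ⟨κ, δ, hκ, hκ8, hδ, hF⟩ := exists_transInstances hB hL hR hLR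
  refine ⟨δ * κ / 4, by positivity, fun H d m hH hd => ?_⟩
  have hH0 : 0 < H := by omega
  obtain ⟨F, hM⟩ := hF H d m hH hd
  refine ⟨F, fun K hK alg => ?_⟩
  have hd' : (1 : ℝ) ≤ d := by exact_mod_cast hd
  have hdK : (d : ℝ) ≤ √(K : ℝ) := Real.le_sqrt_of_sq_le (by exact_mod_cast hK)
  have hK0 : 0 < √(K : ℝ) := by linarith
  have hKK : √(K : ℝ) ^ 2 = K := Real.sq_sqrt (Nat.cast_nonneg K)
  set Δ := κ / √(K : ℝ) with hΔdef
  have hΔ : 0 < Δ := by positivity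
  have hΔK : Δ * √(K : ℝ) = κ := by rw [hΔdef]; field_simp
  have hΔκ : Δ * d ≤ κ := hΔK ▸ mul_le_mul_of_nonneg_left hdK hΔ.le
  have hΔd : Δ * d ≤ 1 / 8 := hΔκ.trans hκ8
  have hΔ8 : Δ ≤ 1 / 8 := (le_mul_of_one_le_right hΔ.le hd').trans hΔd
  obtain ⟨M, hpref, hret, hnone, hsome⟩ := hM Δ hΔ.le hΔκ
  -- A flip shifts the first transition by `2 * Δ`, so each of the two trajectories costs affinity
  -- `4 * Δ ^ 2`. The preference bit costs nothing, since the preferences do not depend on `θ`.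
  have hmain := exists_le_expectedRegret (C := δ * (1 / 2 + Δ * d)) (η := 2 * (δ * Δ))
    (ε := 8 * Δ ^ 2)
    hH0 none (fun θ => (M θ).transition) (fun θ => (M θ).pref)
    (fun θ τ => δ * reachesGood hH τ) (fun θ => (M θ).isPreference) hpref
    (by positivity) (fun θ π => ?_) (fun θ j π₁ π₂ => ?_) (by nlinarith) ?_ alg
  · obtain ⟨θ, h1, h2⟩ := hmain
    refine ⟨M θ, h1, fun πstar hopt => le_trans (le_of_eq ?_) (h2 πstar hopt)⟩
    rw [← hΔK]
    linear_combination (δ * Δ * d / 4) * hKK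
  · have h := sum_trajProb_mul (M θ).transition none hH π
      fun _ s => δ * if s = some true then 1 else 0
    refine h.trans ?_
    have h3 : ∀ a, ∑ s, ((M θ).transition none a : Option Bool → ℝ) s *
        (δ * if s = some true then 1 else 0) = δ / 2 + δ * Δ * signInner θ a := fun a => by
      rw [Fintype.sum_option, Fintype.sum_bool, hnone, hnone, hret]
      simp [boolSign]
      ring
    simp only [h3, mul_add, Finset.sum_add_distrib, ← Finset.sum_mul, sum_firstAction,
      mul_left_comm _ (δ * Δ), ← Finset.mul_sum, sum_firstAction_mul_signInner]
    ring
  · have htraj : ∀ π, 1 - 4 * Δ ^ 2 ≤ ∑ τ, √(trajProb (M θ).transition none π τ *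
        trajProb (M (flipBit j θ)).transition none π τ) := fun π => by
      refine le_sum_sqrt_trajProb hH (hret θ) (fun s a hs => ?_) (by nlinarith) (by nlinarith)
        (fun a => ?_) π
      · obtain ⟨b, rfl⟩ := Option.ne_none_iff_exists'.1 hs
        refine Subtype.ext (funext fun s' => ?_)
        rcases s' with _ | b'
        · exact (hret _ _ _).trans (hret _ _ _).symm
        · exact (hsome _ _ _ _).trans (hsome _ _ _ _).symm
      · have h3 : ∀ θ : Fin d → Bool,
            1 / 2 + Δ * signInner θ a ∈ Set.Icc (1 / 4 : ℝ) (3 / 4) := fun θ => by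
          have h3 := abs_le.1 (abs_signInner_le θ a)
          have h4 := mul_le_mul_of_nonneg_left h3.1 hΔ.le
          have h5 := mul_le_mul_of_nonneg_left h3.2 hΔ.le
          exact ⟨by linarith, by linarith⟩
        have h4 := one_sub_sq_le_sqrt_add_sqrt (h3 θ) (h3 (flipBit j θ))
        have h5 : (1 / 2 + Δ * signInner θ a - (1 / 2 + Δ * signInner (flipBit j θ) a)) ^ 2 =
            4 * Δ ^ 2 * (boolSign (θ j) ^ 2 * boolSign (a j) ^ 2) := by
          rw [signInner_flipBit]
          ring
        rw [h5, boolSign_sq, boolSign_sq, mul_one, mul_one] at h4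
        have h6 : ∀ x : ℝ, 1 - (1 / 2 + x) = 1 / 2 + -1 * x := fun x => by ring
        rw [h6, h6] at h4
        rw [Fintype.sum_option, Fintype.sum_bool, hret, hnone, hnone, hnone, hnone]
        simpa [boolSign] using h4
    have h := mul_le_sum_sqrt_episodeProb (T := (M θ).pref) (T' := (M (flipBit j θ)).pref)
      (σ := 1) (by nlinarith) zero_le_one (htraj π₁) (htraj π₂) fun τ₁ τ₂ => ?_
    · refine le_trans ?_ h
      nlinarith [sq_nonneg (Δ ^ 2)]
    · have h3 := ((M θ).isPreference τ₁ τ₂).1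
      have h4 : (M (flipBit j θ)).pref τ₁ τ₂ = (M θ).pref τ₁ τ₂ := by rw [hpref, hpref]
      have h5 : 0 ≤ (M θ).pref τ₁ τ₂ := h3.1
      have h6 : (M θ).pref τ₁ τ₂ ≤ 1 := h3.2
      rw [h4, Real.sqrt_mul_self h5, Real.sqrt_mul_self (by linarith)]
      linarith
  · have h5 : K * (8 * Δ ^ 2) = 8 * κ ^ 2 := by
      rw [← hΔK]
      linear_combination (-8 * Δ ^ 2) * hKK
    rw [h5]
    nlinarith

end Transition

end

end PbRL

/-! ### Choice of the harder family -/

theorem mainTheorem3 (B L R : ℝ) (hB : 1 < B) (hL : 0 < L) (hR : 0 < R) (hLR : 1 / 2 < L * R) :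
    ∃ c : ℝ, 0 < c ∧ ∀ H dP dT : ℕ, 2 ≤ H → 1 ≤ dP → 1 ≤ dT → 3 ≤ dP + dT →
      ∃ (S A : Type) (_ : Fintype S) (_ : Fintype A) (_ : Nonempty A) (s₁ : S)
        (F : PbRL.LinearFeatures S A H dP dT L),
        ∀ K : ℕ, (dP + dT) ^ 2 ≤ K → ∀ alg : PbRL.Algorithm.{u} S A H K,
          ∃ M : PbRL.LinearInstance F B R,
            (∃ πstar, PbRL.IsOptimal M.transition s₁ M.pref πstar) ∧
            ∀ πstar, PbRL.IsOptimal M.transition s₁ M.pref πstar →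
              c * (dP * √(K : ℝ) + dT * √(K : ℝ)) ≤
                PbRL.expectedRegret M.transition s₁ M.pref πstar alg := by
  obtain ⟨c₁, hc₁, h₁⟩ := PbRL.exists_transFeatures.{u} hB hL hR hLR
  obtain ⟨c₂, hc₂, h₂⟩ := PbRL.exists_prefFeatures.{u} hB hL hR hLR
  -- `x` and `y` are the two dimensions and `z` is the number of hidden bits, one less than the
  -- larger dimension. Since `3 ≤ dP + dT`, `z ≥ 1`, and `x + y ≤ 2 * z + 2 ≤ 4 * z`.
  have key : ∀ {c' x y z s r : ℝ}, min c₁ c₂ ≤ c' → 0 ≤ s → 0 ≤ z → x + y ≤ 4 * z →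
      c' * (z * s) ≤ r → min c₁ c₂ / 4 * (x * s + y * s) ≤ r := fun {c' x y z s r} hc hs hz hxy hr =>
    calc min c₁ c₂ / 4 * (x * s + y * s) = min c₁ c₂ / 4 * ((x + y) * s) := by ring
      _ ≤ min c₁ c₂ / 4 * (4 * z * s) := by
        have := lt_min hc₁ hc₂
        gcongr
      _ = min c₁ c₂ * (z * s) := by ring
      _ ≤ c' * (z * s) := by gcongr
      _ ≤ r := hr
  refine ⟨min c₁ c₂ / 4, by have := lt_min hc₁ hc₂; positivity, fun H dP dT hH hP hT hPT => ?_⟩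
  obtain ⟨p, rfl⟩ : ∃ p, dP = p + 1 := ⟨dP - 1, by omega⟩
  obtain ⟨t, rfl⟩ : ∃ t, dT = t + 1 := ⟨dT - 1, by omega⟩
  rcases lt_or_ge t p with h | h
  · obtain ⟨F, hF⟩ := h₁ H p t hH (by omega)
    refine ⟨Option Bool, Fin p → Bool, inferInstance, inferInstance, inferInstance, none, F,
      fun K hK alg => ?_⟩
    obtain ⟨M, hM, hM'⟩ := hF K (le_trans (Nat.pow_le_pow_left (by omega) 2) hK) alg
    refine ⟨M, hM, fun πstar hopt => key (min_le_left _ _) (Real.sqrt_nonneg _)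
      (Nat.cast_nonneg p) ?_ (hM' πstar hopt)⟩
    norm_cast
    omega
  · obtain ⟨F, hF⟩ := h₂ H t p hH (by omega)
    refine ⟨Unit, Fin t → Bool, inferInstance, inferInstance, inferInstance, (), F,
      fun K hK alg => ?_⟩
    obtain ⟨M, hM, hM'⟩ := hF K (le_trans (Nat.pow_le_pow_left (by omega) 2) hK) alg
    refine ⟨M, hM, fun πstar hopt => key (min_le_right _ _) (Real.sqrt_nonneg _)
      (Nat.cast_nonneg t) ?_ (hM' πstar hopt)⟩
    norm_cast
    omega
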